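/- Let $M,m,l_F,\eta\ge 1$ be integers, $\alpha\in[0,1]$, $\gamma\ge 0$, $P_B,P_c>0$, $q\in[0,1]$. There are $M$ cells, $n_F=m\,l_F$ radio frequency channels, and each fronthaul cable has $l_S=m\eta$ twisted pairs with $l_F$ channels each; $\mu=l_F/n_F=1/m$ is the normalized cable bandwidth, and $\eta=\mu l_S$. Let $\mathbf 1_n$ be the all-ones column of length $n$. Let $\mathbf H\in\mathbb R^{M\times M}$ be the circulant Wyner matrix with unit diagonal and gain $\alpha$ from both neighbouring cells (first column $(1,\alpha,0,\dots,0,\alpha)^T$), let $\mathbf H_c=\gamma\mathbf 1_{l_S}\mathbf 1_{l_S}^T+(1-\gamma)\mathbf I_{l_S}$, $\mathbf G=\frac1\eta(\mathbf I_m\otimes\mathbf 1_\eta)$, and $\lambda=\sqrt{P_c/(P_B(1+2\alpha^2)+1)}$. In one minislot let $\mathbf X\in\mathbb C^{n_F\times M}$ (eMBB signals) have i.i.d. $\mathcal{CN}(0,P_B)$ entries, let the radio noise $\mathbf Z\in\mathbb C^{n_F\times M}$ and the cable noises $\tilde{\mathbf W}_1,\dots,\tilde{\mathbf W}_M\in\mathbb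 C^{l_F\times l_S}$ have i.i.d. $\mathcal{CN}(0,1)$ entries, let $A_1,\dots,A_M$ (URLLC activity) be i.i.d. Bernoulli$(q)$, all independent, and put $\mathbf B=\mathrm{diag}(B_1,\dots,B_M)$ with $B_k=1-A_k$, so that the $B_k$ are i.i.d. Bernoulli$(1-q)$. Under NOMA with puncturing the received samples hit by URLLC are discarded, that is, replaced by noise: the radio signal is $$\mathbf Y=\mathbf X\mathbf H\mathbf B+\mathbf Z ,$$ with columns $\mathbf y_1,\dots,\mathbf y_M$. Edge node $k$ splits $\mathbf y_k$ into $m$ consecutive sub-vectors of length $l_F$, the columns of $\mathbf Y_k\in\mathbb C^{l_F\times m}$, and the baseband unit obtains $$\mathbf r_k=\mathrm{vec}\Big(\big(\lambda(\mathbf Y_k\otimes\mathbf 1_\eta^T)\mathbf H_c+\tilde{\mathbf W}_k\big)\mathbf G\Big),\qquad k=1,\dots,M .$$ Let $\mathbf x=\mathrm{vec}(\mathbf X)$, $\mathbf r=(\mathbf r_1,\dots,\mathbf r_M)$. The eMBB per-user rate, for the above Gaussian signalling and with $\mathbf B$ known to the baseband unit, is $R_B=\frac1{n_FM}I(\mathbf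 x;\mathbf r\mid\mathbf B)$ in bits, where $I(\cdot\,;\cdot\mid\cdot)$ is conditional mutual information. Then this information is finite, and $$R_B=\frac{\mu}{M}\,\mathbb E_{\mathbf B}\Big[\log_2\det\big(\mathbf I+P_B\,\mathbf R_{z_{\rm eq}}^{-1}\mathbf H_{B,{\rm eq}}\mathbf H_{B,{\rm eq}}^T\big)\Big],$$ where $\mathbf H_{B,{\rm eq}}=\mathbf B\mathbf H\otimes\mathbf H_c^\eta$, $\mathbf H_c^\eta=\gamma\eta\,\mathbf 1_m\mathbf 1_m^T+(1-\gamma)\mathbf I_m$ and $\mathbf R_{z_{\rm eq}}=\mathbf I_M\otimes\mathbf H_c^\eta\mathbf H_c^\eta+\frac1{\lambda^2\eta}\mathbf I_{Mm}$. -/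

import Mathlib

open MeasureTheory ProbabilityTheory
open scoped Kronecker ENNReal Matrix

namespace AnalogCRAN

noncomputable section

/-! ### Information measures -/

/-- The circularly symmetric complex Gaussian law `CN(0, v)`: real and imaginary parts are
independent real Gaussians of mean `0` and variance `v / 2`. -/
def complexGaussian (v : ℝ) : Measure ℂ :=
  ((gaussianReal 0 (v / 2).toNNReal).prod (gaussianReal 0 (v / 2).toNNReal)).map
    (fun p => (⟨p.1, p.2⟩ : ℂ))

/-- Mutual information `I(X; Y)`, in nats: the Kullback-Leibler divergence of the joint law from
the product of the marginal laws. -/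
def mutualInfo {Ω E F : Type*} [MeasurableSpace Ω] [MeasurableSpace E] [MeasurableSpace F]
    (X : Ω → E) (Y : Ω → F) (P : Measure Ω) : ℝ≥0∞ :=
  InformationTheory.klDiv (P.map (fun ω => (X ω, Y ω))) ((P.map X).prod (P.map Y))

/-- Conditional mutual information `I(X; Y | A)`, in nats, for a random variable `A` with finitely
many values: the mean over `a` of the mutual information under `P` conditioned on `A = a`. -/
def condMutualInfo {Ω E F S : Type*} [MeasurableSpace Ω] [MeasurableSpace E] [MeasurableSpace F]
    [Fintype S] (X : Ω → E) (Y : Ω → F) (A : Ω → S) (P : Measure Ω) : ℝ≥0∞ :=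
  ∑ a : S, P (A ⁻¹' {a}) * mutualInfo X Y (ProbabilityTheory.cond P (A ⁻¹' {a}))

/-! ### Architecture

There are `M` cells. Every radio band consists of `m` sub-bands of `lF` channels each, so that
`nF = m * lF`; the channel `(j, f)` is the `f`-th one of the `j`-th sub-band. Every fronthaul cable
has `lS = m * η` twisted pairs; the pair `(j, c)` is the `c`-th one of the `j`-th group of `η`
consecutive pairs. -/

/-- The number `nF` of radio frequency channels. -/
abbrev numChannels (m lF : ℕ) : ℕ := Fintype.card (Fin m × Fin lF)

/-- The normalized cable bandwidth `μ = lF / nF`. -/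
def cableBandwidth (m lF : ℕ) : ℝ := (lF : ℝ) / (numChannels m lF : ℝ)

/-- The circulant Wyner channel matrix `H`, with first column `(1, α, 0, …, 0, α)ᵀ`. -/
def wyner (M : ℕ) [NeZero M] (α : ℝ) : Matrix (Fin M) (Fin M) ℝ :=
  Matrix.circulant fun i =>
    (if i = 0 then 1 else 0) + (if i = 1 then α else 0) + (if i = -1 then α else 0)

/-- The cable channel matrix `H_c = γ 1 1ᵀ + (1 - γ) I` between the twisted pairs. -/
def cable (m η : ℕ) (γ : ℝ) : Matrix (Fin m × Fin η) (Fin m × Fin η) ℝ :=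
  γ • Matrix.of (fun _ _ => (1 : ℝ)) + (1 - γ) • (1 : Matrix _ _ ℝ)

/-- The equivalent cable channel matrix `H_c^η = γ η 1 1ᵀ + (1 - γ) I` of size `m = 1 / μ`. -/
def cableEq (m η : ℕ) (γ : ℝ) : Matrix (Fin m) (Fin m) ℝ :=
  (γ * (η : ℝ)) • Matrix.of (fun _ _ => (1 : ℝ)) + (1 - γ) • (1 : Matrix _ _ ℝ)

/-- The combining matrix `G = η⁻¹ (I ⊗ 1_η)` at the cable output. -/
def combiner (m η : ℕ) : Matrix (Fin m × Fin η) (Fin m) ℝ :=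
  Matrix.of fun p j => if p.1 = j then (η : ℝ)⁻¹ else 0

/-- The amplification `λ` at the cable input that enforces the cable power constraint `Pc`. -/
def gain (α PB Pc : ℝ) : ℝ := Real.sqrt (Pc / (PB * (1 + 2 * α ^ 2) + 1))

/-- The matrix `B = diag(B_1, …, B_M)` with `B_k = 1 - A_k`, where `A_k = 1` means that the URLLC
user of cell `k` transmits. -/
def punct {M : ℕ} (a : Fin M → Bool) : Matrix (Fin M) (Fin M) ℝ :=
  Matrix.diagonal fun k => if a k then 0 else 1

/-- The equivalent noise covariance `R_zeq = I ⊗ H_c^η H_c^η + (λ² η)⁻¹ I`. -/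
def noiseCov (M m η : ℕ) (α γ PB Pc : ℝ) : Matrix (Fin M × Fin m) (Fin M × Fin m) ℝ :=
  (1 : Matrix (Fin M) (Fin M) ℝ) ⊗ₖ (cableEq m η γ * cableEq m η γ)
    + (1 / (gain α PB Pc ^ 2 * (η : ℝ))) • (1 : Matrix _ _ ℝ)

/-- The equivalent channel `H_{B,eq} = B H ⊗ H_c^η`. -/
def channelEq {M : ℕ} [NeZero M] (m η : ℕ) (α γ : ℝ) (a : Fin M → Bool) :
    Matrix (Fin M × Fin m) (Fin M × Fin m) ℝ :=
  (punct a * wyner M α) ⊗ₖ cableEq m η γ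

/-! ### Signals in one minislot -/

/-- The radio signal `Y = X H B + Z` of the edge nodes, URLLC-hit columns being discarded. -/
def radioSignal {M m lF : ℕ} [NeZero M] (α : ℝ) (X Z : Fin m × Fin lF → Fin M → ℂ)
    (a : Fin M → Bool) : Matrix (Fin m × Fin lF) (Fin M) ℂ :=
  Matrix.of X * (wyner M α).map Complex.ofReal * (punct a).map Complex.ofReal + Matrix.of Z

/-- The cable signal `λ (vec⁻¹(y) ⊗ 1_ηᵀ)` of an edge node that received the radio signal `y`:
every sub-band is amplified and replicated over `η` consecutive twisted pairs. -/
def cableInput {m lF : ℕ} (η : ℕ) (g : ℝ) (y : Fin m × Fin lF → ℂ) :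
    Matrix (Fin lF) (Fin m × Fin η) ℂ :=
  Matrix.of fun f p => (g : ℂ) * y (p.1, f)

/-- The signal `vec((Ỹ H_c + W̃) G)` of one edge node after transmission over its cable with
noise `W̃`, combining and vectorization. -/
def cableOutput {m lF η : ℕ} (γ : ℝ) (Y : Matrix (Fin lF) (Fin m × Fin η) ℂ)
    (W : Fin lF → Fin m × Fin η → ℂ) : Fin m × Fin lF → ℂ :=
  Matrix.vec ((Y * (cable m η γ).map Complex.ofReal + Matrix.of W)
    * (combiner m η).map Complex.ofReal)

/-- The signals received by the baseband unit from all edge nodes over all radio channels. -/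
def received {M m lF η : ℕ} [NeZero M] (α γ PB Pc : ℝ) (X Z : Fin m × Fin lF → Fin M → ℂ)
    (W : Fin M → Fin lF → Fin m × Fin η → ℂ) (a : Fin M → Bool) :
    Fin M → Fin m × Fin lF → ℂ :=
  fun k => cableOutput γ
    (cableInput η (gain α PB Pc) fun f => radioSignal α X Z a f k) (W k)

/-- The joint law of the signals `X`, the radio noise `Z`, the cable noise `W̃` and the URLLC
activity `A`: all entries are independent, those of `X` are `CN(0, PB)`, those of `Z` and `W̃` are
`CN(0, 1)`, and `A_k = 1` with probability `q`. -/
def frameLaw (M m lF η : ℕ) (PB : ℝ) (q : unitInterval) :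
    Measure ((Fin m × Fin lF → Fin M → ℂ) × (Fin m × Fin lF → Fin M → ℂ) ×
      (Fin M → Fin lF → Fin m × Fin η → ℂ) × (Fin M → Bool)) :=
  (Measure.pi fun _ => Measure.pi fun _ => complexGaussian PB).prod <|
  (Measure.pi fun _ => Measure.pi fun _ => complexGaussian 1).prod <|
  (Measure.pi fun _ => Measure.pi fun _ => Measure.pi fun _ => complexGaussian 1).prod <|
  Measure.pi fun _ => bernoulliMeasure true false q

/-- The information `I(x; r | A)`, in nats, that the received signals carry about the eMBB
signals in one minislot, the URLLC activity being known to the baseband unit. -/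
def eMBBInfo {Ω : Type*} [MeasurableSpace Ω] {M m lF η : ℕ} [NeZero M] (α γ PB Pc : ℝ)
    (P : Measure Ω) (X Z : Ω → Fin m × Fin lF → Fin M → ℂ)
    (W : Ω → Fin M → Fin lF → Fin m × Fin η → ℂ) (A : Ω → Fin M → Bool) : ℝ≥0∞ :=
  condMutualInfo X (fun ω => received α γ PB Pc (X ω) (Z ω) (W ω) (A ω)) A P

/-- The eMBB per-user information rate `I(x; r | A) / (nF M)`, in bits per radio resource. -/
def eMBBRate {Ω : Type*} [MeasurableSpace Ω] {M m lF η : ℕ} [NeZero M] (α γ PB Pc : ℝ)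
    (P : Measure Ω) (X Z : Ω → Fin m × Fin lF → Fin M → ℂ)
    (W : Ω → Fin M → Fin lF → Fin m × Fin η → ℂ) (A : Ω → Fin M → Bool) : ℝ :=
  (eMBBInfo α γ PB Pc P X Z W A).toReal / Real.log 2 / ((numChannels m lF : ℝ) * (M : ℝ))

end

end AnalogCRAN

/-!
Given the URLLC activity pattern `a`, the baseband unit observes a fixed linear Gaussian channel
`r = T x + N w`, where `x` holds the normalized eMBB signals and `w` stacks the radio and cable
noises (`received_eq_mulVec`). Averaging the `η` pairs of a group turns the cable matrix into
`H_c^η` and divides the cable noise power by `η`. Hence, up to the factor `λ²` and a relabelling of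
the indices, `T Tᵀ = P_B H_{B,eq} H_{B,eq}ᵀ ⊗ I` and `N Nᵀ = R_zeq ⊗ I`, with one tensor copy for
each of the `lF` channels of a sub-band (`signalMatrix_mul_transpose`,
`noiseMatrix_mul_transpose`).

The information of such a channel is `log (det (T Tᴴ + N Nᴴ) / det (N Nᴴ))`
(`mutualInfo_linear_channel`). The joint law of `(x, r)` and the product of its marginals are both
linear images of standard complex Gaussian vectors. Linear images with the same covariance `A Aᴴ`
have the same law (`map_mulVec_eq_of_mul_conjTranspose_eq`, by characteristic functions), and
divergence is invariant under invertible maps. So it suffices to know the divergence of the law of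
`L g` from the law of `g` for a square invertible `L`, which is `‖L‖_F² - dim - log |det L|²` by the
change of variables formula (`klDiv_map_mulVec`). For the matrix `L` that arises from the channel
the first two terms cancel.

The determinant identity `log_det_ratio` gives `lF log det (I + P_B R_zeq⁻¹ H_{B,eq} H_{B,eq}ᵀ)` for
each pattern. Conditioning on `A = a` does not change the law of the signals (`cond_map_signals`),
so the conditional information is the finite average of these values over `a`.
-/

open scoped ComplexOrder

namespace AnalogCRAN

/-! ### The circularly symmetric complex Gaussian law -/

lemma measurable_complex_mk : Measurable (fun p : ℝ × ℝ => (⟨p.1, p.2⟩ : ℂ)) :=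
  Complex.measurableEquivRealProd.symm.measurable

instance isProbabilityMeasure_complexGaussian (v : ℝ) :
    IsProbabilityMeasure (complexGaussian v) :=
  Measure.isProbabilityMeasure_map measurable_complex_mk.aemeasurable

/-- The standard circularly symmetric complex Gaussian law on `ℂ^ι`. -/
noncomputable def stdComplexGaussian (ι : Type*) [Fintype ι] : Measure (ι → ℂ) :=
  Measure.pi fun _ => complexGaussian 1

instance isProbabilityMeasure_stdComplexGaussian (ι : Type*) [Fintype ι] :
    IsProbabilityMeasure (stdComplexGaussian ι) := by
  unfold stdComplexGaussian; infer_instance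

lemma charFunDual_complexGaussian {v : ℝ} (hv : 0 ≤ v) (L : StrongDual ℝ ℂ) :
    charFunDual (complexGaussian v) L
      = Complex.exp (-((v * (L 1 ^ 2 + L Complex.I ^ 2) / 4 : ℝ) : ℂ)) := by
  have h : (fun p : ℝ × ℝ => (⟨p.1, p.2⟩ : ℂ)) = Complex.equivRealProdCLM.symm := rfl
  unfold complexGaussian
  rw [h]
  erw [charFunDual_map (Complex.equivRealProdCLM.symm : ℝ × ℝ →L[ℝ] ℂ) L]
  rw [charFunDual_prod, charFunDual_eq_charFun_map_one, charFunDual_eq_charFun_map_one]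
  have e1 : ∀ L' : StrongDual ℝ ℝ, ⇑L' = fun x => L' 1 * x := fun L' => by
    ext x
    conv_lhs => rw [← mul_one x, ← smul_eq_mul, map_smul, smul_eq_mul, mul_comm]
  have i1 : Complex.equivRealProdCLM.symm ((1 : ℝ), (0 : ℝ)) = 1 := by
    apply Complex.ext <;> simp
  have i2 : Complex.equivRealProdCLM.symm ((0 : ℝ), (1 : ℝ)) = Complex.I := by
    apply Complex.ext <;> simp
  rw [e1 (_ ∘SL ContinuousLinearMap.inl ℝ ℝ ℝ), e1 (_ ∘SL ContinuousLinearMap.inr ℝ ℝ ℝ),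
    gaussianReal_map_const_mul, gaussianReal_map_const_mul, charFun_gaussianReal,
    charFun_gaussianReal, ← Complex.exp_add]
  congr 1
  simp only [ContinuousLinearMap.comp_apply, ContinuousLinearMap.inl_apply,
    ContinuousLinearMap.inr_apply, ContinuousLinearEquiv.coe_coe, i1, i2]
  simp only [NNReal.coe_mul, NNReal.coe_mk, Real.coe_toNNReal _ (by positivity : 0 ≤ v / 2)]
  push_cast
  ring

/-- A real-linear functional on `ℂ` in terms of its values at `1` and `I`. -/
lemma strongDual_complex_apply (L : StrongDual ℝ ℂ) (z : ℂ) :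
    L z = z.re * L 1 + z.im * L Complex.I := by
  conv_lhs => rw [← Complex.re_add_im z]
  have h1 : (z.re : ℂ) = z.re • (1 : ℂ) := by simp
  have h2 : (z.im : ℂ) * Complex.I = z.im • Complex.I := by simp
  rw [map_add, h1, h2, map_smul, map_smul, smul_eq_mul, smul_eq_mul]

/-- The exponent is written with the values of `L` at the real basis `e_i`, `I e_i` of `ℂ^ι`. -/
lemma charFunDual_stdComplexGaussian {ι : Type*} [Fintype ι] [DecidableEq ι]
    (L : StrongDual ℝ (ι → ℂ)) :
    charFunDual (stdComplexGaussian ι) L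
      = Complex.exp (-((∑ i, (L (Pi.single i 1) ^ 2
          + L (Pi.single i Complex.I) ^ 2) / 4 : ℝ) : ℂ)) := by
  unfold stdComplexGaussian
  rw [charFunDual_pi]
  simp_rw [charFunDual_complexGaussian zero_le_one]
  rw [← Complex.exp_sum]
  congr 1
  push_cast
  rw [← Finset.sum_neg_distrib]
  simp

/-- Multiplication by a complex matrix as a real-linear continuous map. -/
noncomputable def mulVecCLM {ι κ : Type*} [Fintype ι] [Fintype κ] (A : Matrix κ ι ℂ) :
    (ι → ℂ) →L[ℝ] (κ → ℂ) :=
  (A.mulVecLin.restrictScalars ℝ).toContinuousLinearMap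

@[simp] lemma coe_mulVecCLM {ι κ : Type*} [Fintype ι] [Fintype κ] (A : Matrix κ ι ℂ) :
    ⇑(mulVecCLM A) = A.mulVec := rfl

lemma measurable_mulVec {ι κ : Type*} [Fintype ι] [Fintype κ] (A : Matrix κ ι ℂ) :
    Measurable A.mulVec := (mulVecCLM A).continuous.measurable

/-- The covariance `A Aᴴ` determines the characteristic function of `A g`, `g` standard complex
Gaussian: for the functional `x ↦ Re ⟪c, x⟫` the exponent is `-(c* A Aᴴ c) / 4`. -/
lemma charFunDual_map_mulVec {ι κ : Type*} [Fintype ι] [Fintype κ] [DecidableEq κ]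
    (A : Matrix κ ι ℂ) (L : StrongDual ℝ (κ → ℂ)) (c : κ → ℂ)
    (hc : ∀ k, c k = L (Pi.single k 1) + L (Pi.single k Complex.I) * Complex.I) :
    charFunDual ((stdComplexGaussian ι).map A.mulVec) L
      = Complex.exp (-(star c ⬝ᵥ ((A * Aᴴ) *ᵥ c)) / 4) := by
  classical
  rw [← coe_mulVecCLM, charFunDual_map, charFunDual_stdComplexGaussian]
  congr 1
  have hL : ∀ x : κ → ℂ, L x = ∑ k, ((c k).re * (x k).re + (c k).im * (x k).im) := by
    intro x
    have : x = ∑ k, Pi.single k (x k) := (Finset.univ_sum_single x).symm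
    conv_lhs => rw [this, map_sum]
    refine Finset.sum_congr rfl fun k _ => ?_
    have := strongDual_complex_apply (L ∘SL ContinuousLinearMap.single ℝ (fun _ : κ => ℂ) k) (x k)
    simp only [ContinuousLinearMap.comp_apply, ContinuousLinearMap.single_apply] at this
    rw [this, hc]
    simp
    ring
  have hd : ∀ i, ((L (A *ᵥ Pi.single i 1) ^ 2 + L (A *ᵥ Pi.single i Complex.I) ^ 2 : ℝ) : ℂ)
      = star ((Aᴴ *ᵥ c) i) * (Aᴴ *ᵥ c) i := by
    intro i
    have hA : ∀ z k, (A *ᵥ Pi.single i z) k = A k i * z := fun z k => by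
      simp [Matrix.mulVec_single]
    rw [Complex.star_def, mul_comm, Complex.mul_conj, Complex.normSq_apply, hL, hL]
    simp only [hA]
    simp only [Matrix.mulVec, dotProduct, Complex.re_sum, Complex.im_sum,
      Matrix.conjTranspose_apply, Complex.mul_re, Complex.mul_im, Complex.star_def,
      Complex.conj_re, Complex.conj_im, Complex.one_re, Complex.one_im, Complex.I_re, Complex.I_im]
    rw [sq, sq]
    congr 3 <;> exact Finset.sum_congr rfl fun k _ => by ring
  have hs : star c ⬝ᵥ ((A * Aᴴ) *ᵥ c) = star (Aᴴ *ᵥ c) ⬝ᵥ (Aᴴ *ᵥ c) := by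
    rw [Matrix.star_mulVec, Matrix.conjTranspose_conjTranspose, ← Matrix.mulVec_mulVec,
      Matrix.dotProduct_mulVec]
  rw [hs]
  simp only [ContinuousLinearMap.comp_apply, coe_mulVecCLM, dotProduct, Pi.star_apply]
  rw [neg_div, Finset.sum_div, Complex.ofReal_sum]
  congr 1
  refine Finset.sum_congr rfl fun i _ => ?_
  rw [← hd]
  push_cast
  ring

/-- Linear images of standard complex Gaussian vectors with the same covariance have the same
law. -/
lemma map_mulVec_eq_of_mul_conjTranspose_eq {ι ι' κ : Type*} [Fintype ι] [Fintype ι'] [Fintype κ]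
    (A : Matrix κ ι ℂ) (A' : Matrix κ ι' ℂ) (h : A * Aᴴ = A' * A'ᴴ) :
    (stdComplexGaussian ι).map A.mulVec = (stdComplexGaussian ι').map A'.mulVec := by
  classical
  have := Measure.isProbabilityMeasure_map (μ := stdComplexGaussian ι)
    (measurable_mulVec A).aemeasurable
  have := Measure.isProbabilityMeasure_map (μ := stdComplexGaussian ι')
    (measurable_mulVec A').aemeasurable
  refine Measure.ext_of_charFunDual (funext fun L => ?_)
  rw [charFunDual_map_mulVec A L _ fun _ => rfl, charFunDual_map_mulVec A' L _ fun _ => rfl, h]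

/-- Scaling `CN(0, 1)` by `√v` gives `CN(0, v)`. -/
lemma complexGaussian_map_mul {v : ℝ} (hv : 0 ≤ v) :
    (complexGaussian 1).map (fun z => (Real.sqrt v : ℂ) * z) = complexGaussian v := by
  have hm : (fun z : ℂ => (Real.sqrt v : ℂ) * z) = ⇑(Real.sqrt v • ContinuousLinearMap.id ℝ ℂ) := by
    ext z; simp
  have : IsProbabilityMeasure ((complexGaussian 1).map (fun z => (Real.sqrt v : ℂ) * z)) :=
    Measure.isProbabilityMeasure_map (by fun_prop)
  refine Measure.ext_of_charFunDual (funext fun L => ?_)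
  rw [hm, charFunDual_map, charFunDual_complexGaussian zero_le_one, charFunDual_complexGaussian hv]
  congr 3
  simp
  rw [mul_pow, mul_pow, Real.sq_sqrt hv]; ring

lemma integrable_normSq_complexGaussian_one :
    Integrable (fun z : ℂ => ‖z‖ ^ 2) (complexGaussian 1) ∧
      ∫ z, ‖z‖ ^ 2 ∂(complexGaussian 1) = 1 := by
  have hsq : Integrable (fun x : ℝ => x ^ 2) (gaussianReal 0 (1 / 2 : ℝ).toNNReal) :=
    (memLp_id_gaussianReal (μ := 0) (v := (1 / 2 : ℝ).toNNReal) 2).integrable_sq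
  have hint : ∫ x : ℝ, x ^ 2 ∂(gaussianReal 0 (1 / 2 : ℝ).toNNReal) = 1 / 2 := by
    have := variance_id_gaussianReal (μ := 0) (v := (1 / 2 : ℝ).toNNReal)
    rw [variance_of_integral_eq_zero aemeasurable_id (by simp [integral_id_gaussianReal])] at this
    rw [Real.coe_toNNReal _ (by norm_num)] at this
    simpa using this
  have hn : (fun p : ℝ × ℝ => ‖(⟨p.1, p.2⟩ : ℂ)‖ ^ 2) = fun p => p.1 ^ 2 + p.2 ^ 2 := by
    ext p
    rw [← Complex.normSq_eq_norm_sq, Complex.normSq_apply]; ring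
  have i1 := hsq.comp_fst (gaussianReal 0 (1 / 2 : ℝ).toNNReal)
  have i2 := hsq.comp_snd (gaussianReal 0 (1 / 2 : ℝ).toNNReal)
  unfold complexGaussian
  constructor
  · rw [integrable_map_measure (by fun_prop) measurable_complex_mk.aemeasurable]
    simp only [Function.comp_def, hn]
    exact i1.add i2
  · rw [integral_map measurable_complex_mk.aemeasurable (by fun_prop), hn, integral_add i1 i2,
      integral_fun_fst (fun x : ℝ => x ^ 2), integral_fun_snd (fun x : ℝ => x ^ 2), hint]
    simp; norm_num

/-- The density of `CN(0, 1)`. -/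
lemma complexGaussian_one_eq_withDensity :
    complexGaussian 1
      = volume.withDensity (fun z : ℂ => ENNReal.ofReal (Real.pi⁻¹ * Real.exp (-‖z‖ ^ 2))) := by
  have hv : (1 / 2 : ℝ).toNNReal ≠ 0 := by simp
  unfold complexGaussian
  rw [gaussianReal_of_var_ne_zero _ hv,
    prod_withDensity (measurable_gaussianPDF _ _) (measurable_gaussianPDF _ _)]
  ext s hs
  rw [Measure.map_apply measurable_complex_mk hs, withDensity_apply _ (measurable_complex_mk hs),
    withDensity_apply _ hs,
    ← (Complex.volume_preserving_equiv_real_prod.symm).setLIntegral_comp_preimage hs (by fun_prop)]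
  refine setLIntegral_congr_fun (measurable_complex_mk hs) fun p _ => ?_
  simp only [gaussianPDF, gaussianPDFReal, Complex.measurableEquivRealProd_symm_apply]
  rw [← ENNReal.ofReal_mul (by positivity), Real.coe_toNNReal _ (by norm_num)]
  congr 1
  rw [← Complex.normSq_eq_norm_sq, Complex.normSq_apply]
  rw [mul_mul_mul_comm, ← Real.exp_add, ← mul_inv, Real.mul_self_sqrt (by positivity)]
  congr 2
  · ring
  · simp; ring

/-! ### Divergence between linear images of Gaussian vectors -/

lemma indicator_ofReal {α : Type*} (t : Set α) (g : α → ℝ) :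
    t.indicator (fun x => ENNReal.ofReal (g x)) = fun x => ENNReal.ofReal (t.indicator g x) := by
  ext x; by_cases h : x ∈ t <;> simp [h]

/-- A product of measures with densities has the product density. -/
lemma volume_pi_withDensity_prod {ι : Type*} [Fintype ι] {f : ι → ℂ → ℝ}
    (hf : ∀ i, Integrable (f i)) (h0 : ∀ i x, 0 ≤ f i x) :
    Measure.pi (fun i => (volume : Measure ℂ).withDensity fun x => ENNReal.ofReal (f i x))
      = (volume : Measure (ι → ℂ)).withDensity fun x => ENNReal.ofReal (∏ i, f i (x i)) := by
  have := fun i => isFiniteMeasure_withDensity_ofReal (hf i).2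
  refine Measure.pi_eq fun s hs => ?_
  have hp : ∀ x : ι → ℂ, (Set.univ.pi s).indicator (fun x => ∏ i, f i (x i)) x
      = ∏ i, (s i).indicator (f i) (x i) := by
    intro x
    by_cases hx : x ∈ Set.univ.pi s
    · rw [Set.indicator_of_mem hx]
      exact Finset.prod_congr rfl fun i _ => (Set.indicator_of_mem (hx i trivial) _).symm
    · rw [Set.indicator_of_notMem hx]
      simp only [Set.mem_pi, Set.mem_univ, true_imp_iff, not_forall] at hx
      obtain ⟨i, hi⟩ := hx
      exact (Finset.prod_eq_zero (Finset.mem_univ i) (Set.indicator_of_notMem hi _)).symm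
  have hI : ∀ i, Integrable ((s i).indicator (f i)) := fun i => (hf i).indicator (hs i)
  rw [withDensity_apply _ (MeasurableSet.univ_pi hs),
    ← lintegral_indicator (MeasurableSet.univ_pi hs)]
  rw [indicator_ofReal, ← ofReal_integral_eq_lintegral_ofReal, funext hp,
    integral_fintype_prod_volume_eq_prod,
    ENNReal.ofReal_prod_of_nonneg]
  · refine Finset.prod_congr rfl fun i _ => ?_
    rw [withDensity_apply _ (hs i), ← lintegral_indicator (hs i), indicator_ofReal,
      ofReal_integral_eq_lintegral_ofReal (hI i)]
    exact Filter.Eventually.of_forall fun x => Set.indicator_nonneg (fun x _ => h0 i x) x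
  · exact fun i _ => integral_nonneg fun x => Set.indicator_nonneg (fun x _ => h0 i x) x
  · rw [funext hp]
    exact Integrable.fintype_prod hI
  · exact Filter.Eventually.of_forall fun x =>
      Set.indicator_nonneg (fun x _ => Finset.prod_nonneg fun i _ => h0 i _) x

/-- The density of the standard complex Gaussian law on `ℂ^ι`. -/
lemma stdComplexGaussian_eq_withDensity (ι : Type*) [Fintype ι] :
    stdComplexGaussian ι = volume.withDensity fun x : ι → ℂ =>
      ENNReal.ofReal (Real.pi⁻¹ ^ Fintype.card ι * Real.exp (-∑ i, ‖x i‖ ^ 2)) := by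
  have hI : Integrable (fun z : ℂ => Real.pi⁻¹ * Real.exp (-‖z‖ ^ 2)) := by
    refine ⟨by fun_prop, ?_⟩
    have h : IsFiniteMeasure ((volume : Measure ℂ).withDensity
        fun z => ENNReal.ofReal (Real.pi⁻¹ * Real.exp (-‖z‖ ^ 2))) := by
      rw [← complexGaussian_one_eq_withDensity]; infer_instance
    have h2 := h.measure_univ_lt_top
    rw [withDensity_apply _ MeasurableSet.univ, Measure.restrict_univ] at h2
    rw [hasFiniteIntegral_iff_ofReal (Filter.Eventually.of_forall fun z => by positivity)]
    exact h2
  unfold stdComplexGaussian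
  simp_rw [complexGaussian_one_eq_withDensity]
  rw [volume_pi_withDensity_prod (fun _ => hI) fun _ z => by positivity]
  congr 1
  ext x
  rw [Finset.prod_mul_distrib, Finset.prod_const, ← Real.exp_sum, Finset.sum_neg_distrib,
    Finset.card_univ]

/-- An invertible complex matrix acts on `ℂ^κ ≃ ℝ^(2κ)` with real Jacobian `|det L|²`. -/
lemma volume_map_mulVec {κ : Type*} [Fintype κ] [DecidableEq κ] (L : Matrix κ κ ℂ)
    (hL : L.det ≠ 0) :
    (volume : Measure (κ → ℂ)).map L.mulVec = ENNReal.ofReal (‖L.det‖ ^ 2)⁻¹ • volume := by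
  have hd : LinearMap.det (L.mulVecLin.restrictScalars ℝ) = ‖L.det‖ ^ 2 := by
    rw [LinearMap.det_restrictScalars, Algebra.norm_complex_apply, Complex.normSq_eq_norm_sq,
      ← Matrix.toLin'_apply', LinearMap.det_toLin']
  have h0 : LinearMap.det (L.mulVecLin.restrictScalars ℝ) ≠ 0 := by rw [hd]; simpa using hL
  have := Measure.map_linearMap_addHaar_eq_smul_addHaar (volume : Measure (κ → ℂ)) h0
  rw [hd, abs_of_nonneg (by positivity)] at this
  exact this

/-- Change of variables: the density of the law of `L g` with respect to that of `g`. -/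
lemma stdComplexGaussian_map_mulVec_eq_withDensity {κ : Type*} [Fintype κ] [DecidableEq κ]
    (L : Matrix κ κ ℂ) (hL : L.det ≠ 0) :
    (stdComplexGaussian κ).map L.mulVec = (stdComplexGaussian κ).withDensity fun x =>
      ENNReal.ofReal ((‖L.det‖ ^ 2)⁻¹ * Real.exp (∑ i, ‖x i‖ ^ 2 - ∑ i, ‖(L⁻¹ *ᵥ x) i‖ ^ 2)) := by
  have hm : Measurable L.mulVec := measurable_mulVec L
  have hm' : Measurable L⁻¹.mulVec := measurable_mulVec L⁻¹
  have hi : ∀ x, L⁻¹ *ᵥ (L *ᵥ x) = x := fun x => by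
    rw [Matrix.mulVec_mulVec, Matrix.nonsing_inv_mul _ hL.isUnit, Matrix.one_mulVec]
  set φ : (κ → ℂ) → ℝ≥0∞ := fun x =>
      ENNReal.ofReal (Real.pi⁻¹ ^ Fintype.card κ * Real.exp (-∑ i, ‖x i‖ ^ 2)) with hφ
  have hφm : Measurable φ := by fun_prop
  have hmi : ∀ i, Measurable fun x => (L⁻¹ *ᵥ x) i := fun i => (measurable_pi_apply i).comp hm'
  rw [stdComplexGaussian_eq_withDensity, ← withDensity_mul _ (by fun_prop) (by fun_prop)]
  ext s hs
  rw [Measure.map_apply hm hs, withDensity_apply _ (hm hs), withDensity_apply _ hs]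
  have e : ∫⁻ x in L.mulVec ⁻¹' s, φ x
      = ∫⁻ y in s, φ (L⁻¹ *ᵥ y) ∂((volume : Measure (κ → ℂ)).map L.mulVec) := by
    rw [setLIntegral_map hs (show Measurable fun y => φ (L⁻¹ *ᵥ y) from hφm.comp hm') hm]
    simp only [hi]
  change ∫⁻ x in _, φ x = _
  rw [e, volume_map_mulVec L hL,
    Measure.restrict_smul, lintegral_smul_measure, smul_eq_mul,
    ← lintegral_const_mul _ (by exact hφm.comp hm')]
  refine setLIntegral_congr_fun hs fun x _ => ?_
  simp only [hφ, Pi.mul_apply]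
  rw [← ENNReal.ofReal_mul (by positivity), ← ENNReal.ofReal_mul (by positivity)]
  congr 1
  rw [sub_eq_add_neg, Real.exp_add, Real.exp_neg (∑ i, ‖x i‖ ^ 2)]
  field_simp

/-- The second moment of a coordinate of `A g`. That coordinate has the law of one complex Gaussian
variable scaled by the norm of the row of `A`, so no cross terms have to be integrated. -/
lemma integral_normSq_mulVec {ι κ : Type*} [Fintype ι] [Fintype κ] (A : Matrix κ ι ℂ) (k : κ) :
    Integrable (fun x => ‖(A *ᵥ x) k‖ ^ 2) (stdComplexGaussian ι) ∧
      ∫ x, ‖(A *ᵥ x) k‖ ^ 2 ∂(stdComplexGaussian ι) = ((A * Aᴴ) k k).re := by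
  set v : ℝ := ((A * Aᴴ) k k).re with hv
  have hAA : (A * Aᴴ) k k = ((∑ i, ‖A k i‖ ^ 2 : ℝ) : ℂ) := by
    simp only [Matrix.mul_apply, Matrix.conjTranspose_apply, Complex.star_def, Complex.mul_conj,
      Complex.normSq_eq_norm_sq]
    push_cast; rfl
  have hv' : v = ∑ i, ‖A k i‖ ^ 2 := by rw [hv, hAA, Complex.ofReal_re]
  have hv0 : 0 ≤ v := by rw [hv']; positivity
  let a : Matrix Unit ι ℂ := Matrix.of fun _ i => A k i
  let b : Matrix Unit Unit ℂ := Matrix.of fun _ _ => (Real.sqrt v : ℂ)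
  have hab : a * aᴴ = b * bᴴ := by
    ext i j
    have : (a * aᴴ) i j = (A * Aᴴ) k k := rfl
    rw [this, hAA, ← hv']
    simp only [b, Matrix.mul_apply, Matrix.conjTranspose_apply, Matrix.of_apply, Complex.star_def,
      Complex.conj_ofReal]
    simp only [Finset.univ_unique, Finset.sum_const, Finset.card_singleton, one_smul]
    rw [← Complex.ofReal_mul, Real.mul_self_sqrt hv0]
  have hmap := map_mulVec_eq_of_mul_conjTranspose_eq a b hab
  have ha : (fun x => ‖(A *ᵥ x) k‖ ^ 2) = (fun y : Unit → ℂ => ‖y ()‖ ^ 2) ∘ a.mulVec := rfl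
  have hb : (fun y : Unit → ℂ => ‖y ()‖ ^ 2) ∘ b.mulVec = fun y => v * ‖y ()‖ ^ 2 := by
    ext y
    simp [b, Matrix.mulVec, dotProduct, mul_pow, Real.sq_sqrt hv0]
  have hc : Continuous fun y : Unit → ℂ => ‖y ()‖ ^ 2 := by fun_prop
  have he : MeasurePreserving (fun y : Unit → ℂ => y ()) (stdComplexGaussian Unit)
      (complexGaussian 1) := measurePreserving_eval _ ()
  have hq := integrable_normSq_complexGaussian_one
  constructor
  · rw [ha, ← integrable_map_measure hc.aestronglyMeasurable (measurable_mulVec a).aemeasurable,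
      hmap,
      integrable_map_measure hc.aestronglyMeasurable (measurable_mulVec b).aemeasurable, hb]
    exact (he.integrable_comp_of_integrable hq.1).const_mul v
  · rw [ha]
    simp only [Function.comp_def]
    rw [← integral_map (f := fun y : Unit → ℂ => ‖y ()‖ ^ 2) (measurable_mulVec a).aemeasurable
      hc.aestronglyMeasurable, hmap,
      integral_map (measurable_mulVec b).aemeasurable hc.aestronglyMeasurable]
    have := he.integral_comp' (f := MeasurableEquiv.funUnique Unit ℂ) (fun z => ‖z‖ ^ 2)
    change ∫ x, ((fun y : Unit → ℂ => ‖y ()‖ ^ 2) ∘ b.mulVec) x ∂_ = _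
    rw [hb, integral_const_mul]
    have h2 : ∫ x : Unit → ℂ, ‖x ()‖ ^ 2 ∂(stdComplexGaussian Unit)
        = ∫ z, ‖z‖ ^ 2 ∂(complexGaussian 1) := this
    rw [h2, hq.2, mul_one]

open InformationTheory in
/-- The divergence of the law of `L g` from that of `g`, for `L` invertible and `g` standard complex
Gaussian. It is finite and equals `‖L‖_F² - dim - log |det L|²`. -/
lemma klDiv_map_mulVec {κ : Type*} [Fintype κ] [DecidableEq κ] (L : Matrix κ κ ℂ)
    (hL : L.det ≠ 0) :
    klDiv ((stdComplexGaussian κ).map L.mulVec) (stdComplexGaussian κ) ≠ ⊤ ∧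
      (klDiv ((stdComplexGaussian κ).map L.mulVec) (stdComplexGaussian κ)).toReal =
        (L * Lᴴ).trace.re - Fintype.card κ - Real.log (‖L.det‖ ^ 2) := by
  have hm : Measurable L.mulVec := measurable_mulVec L
  have hm' : Measurable L⁻¹.mulVec := measurable_mulVec L⁻¹
  have hi : ∀ x, L⁻¹ *ᵥ (L *ᵥ x) = x := fun x => by
    rw [Matrix.mulVec_mulVec, Matrix.nonsing_inv_mul _ hL.isUnit, Matrix.one_mulVec]
  have hmi : ∀ i, Measurable fun x => (L⁻¹ *ᵥ x) i := fun i => (measurable_pi_apply i).comp hm'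
  have hdens := stdComplexGaussian_map_mulVec_eq_withDensity L hL
  set γ := stdComplexGaussian κ with hγ
  have hac : γ.map L.mulVec ≪ γ := by rw [hdens]; exact withDensity_absolutelyContinuous _ _
  have : IsProbabilityMeasure (γ.map L.mulVec) := Measure.isProbabilityMeasure_map hm.aemeasurable
  have hpos : (0 : ℝ) < ‖L.det‖ ^ 2 := by positivity
  have hllr : llr (γ.map L.mulVec) γ =ᵐ[γ.map L.mulVec] fun x =>
      ∑ i, ‖x i‖ ^ 2 - ∑ i, ‖(L⁻¹ *ᵥ x) i‖ ^ 2 - Real.log (‖L.det‖ ^ 2) := by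
    have h1 : (γ.map L.mulVec).rnDeriv γ =ᵐ[γ] fun x =>
        ENNReal.ofReal ((‖L.det‖ ^ 2)⁻¹ * Real.exp (∑ i, ‖x i‖ ^ 2 - ∑ i, ‖(L⁻¹ *ᵥ x) i‖ ^ 2)) := by
      rw [hdens]; exact Measure.rnDeriv_withDensity _ (by fun_prop)
    filter_upwards [hac.ae_le h1] with x hx
    simp only [llr_def]
    rw [hx, ENNReal.toReal_ofReal (by positivity), Real.log_mul (by positivity)
      (Real.exp_pos _).ne', Real.log_exp, Real.log_inv]
    ring
  have hA := fun i => integral_normSq_mulVec L i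
  have hB := fun i => integral_normSq_mulVec (1 : Matrix κ κ ℂ) i
  simp only [Matrix.one_mulVec, Matrix.conjTranspose_one, mul_one, Matrix.one_apply_eq,
    Complex.one_re] at hB
  have hIA : Integrable (fun x => ∑ i, ‖(L *ᵥ x) i‖ ^ 2) γ :=
    integrable_finsetSum _ fun i _ => (hA i).1
  have hIB : Integrable (fun x => ∑ i, ‖x i‖ ^ 2) γ := integrable_finsetSum _ fun i _ => (hB i).1
  have hmeas : Measurable fun x : κ → ℂ =>
      ∑ i, ‖x i‖ ^ 2 - ∑ i, ‖(L⁻¹ *ᵥ x) i‖ ^ 2 - Real.log (‖L.det‖ ^ 2) := by fun_prop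
  have hint : Integrable (llr (γ.map L.mulVec) γ) (γ.map L.mulVec) := by
    rw [integrable_congr hllr, integrable_map_measure hmeas.aestronglyMeasurable hm.aemeasurable]
    simp only [Function.comp_def, hi]
    exact (hIA.sub hIB).sub (integrable_const _)
  refine ⟨klDiv_ne_top hac hint, ?_⟩
  rw [toReal_klDiv_of_measure_eq hac (by simp), integral_congr_ae hllr,
    integral_map hm.aemeasurable hmeas.aestronglyMeasurable]
  simp only [hi]
  rw [integral_sub (f := fun x => ∑ i, ‖(L *ᵥ x) i‖ ^ 2 - ∑ i, ‖x i‖ ^ 2) (hIA.sub hIB)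
    (integrable_const _), integral_sub hIA hIB,
    integral_finsetSum _ fun i _ => (hA i).1, integral_finsetSum _ fun i _ => (hB i).1]
  simp [(hA _).2, (hB _).2, Matrix.trace, Complex.re_sum]

open InformationTheory in
lemma klDiv_map_measurableEquiv {α β : Type*} [MeasurableSpace α] [MeasurableSpace β]
    (μ ν : Measure α) [IsFiniteMeasure μ] [IsFiniteMeasure ν] (e : α ≃ᵐ β) :
    klDiv (μ.map e) (ν.map e) = klDiv μ ν := by
  refine le_antisymm (klDiv_map_le μ ν e.measurable) ?_
  have := klDiv_map_le (μ.map e) (ν.map e) e.symm.measurable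
  simpa using this

/-! ### Mutual information of a linear Gaussian channel -/

section MutualInfo

variable {Ω Ω' E E' F F' : Type*} [MeasurableSpace Ω] [MeasurableSpace Ω'] [MeasurableSpace E]
  [MeasurableSpace E'] [MeasurableSpace F] [MeasurableSpace F']

lemma mutualInfo_map {P : Measure Ω} {Φ : Ω → Ω'} (hΦ : AEMeasurable Φ P) {X : Ω' → E} {Y : Ω' → F}
    (hX : Measurable X) (hY : Measurable Y) :
    mutualInfo X Y (P.map Φ) = mutualInfo (X ∘ Φ) (Y ∘ Φ) P := by
  unfold mutualInfo
  rw [AEMeasurable.map_map_of_aemeasurable (hX.prodMk hY).aemeasurable hΦ,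
    AEMeasurable.map_map_of_aemeasurable hX.aemeasurable hΦ,
    AEMeasurable.map_map_of_aemeasurable hY.aemeasurable hΦ]
  rfl

lemma mutualInfo_congr {P : Measure Ω} {X X' : Ω → E} {Y Y' : Ω → F} (hX : X =ᵐ[P] X')
    (hY : Y =ᵐ[P] Y') : mutualInfo X Y P = mutualInfo X' Y' P := by
  unfold mutualInfo
  rw [Measure.map_congr hX, Measure.map_congr hY]
  congr 1
  refine Measure.map_congr ?_
  filter_upwards [hX, hY] with ω h1 h2
  rw [h1, h2]

/-- Mutual information does not change when both variables are recoded bijectively. -/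
lemma mutualInfo_measurableEquiv_comp {P : Measure Ω} [IsFiniteMeasure P] {X : Ω → E} {Y : Ω → F}
    (hX : Measurable X) (hY : Measurable Y) (e : E ≃ᵐ E') (f : F ≃ᵐ F') :
    mutualInfo (e ∘ X) (f ∘ Y) P = mutualInfo X Y P := by
  unfold mutualInfo
  have h := klDiv_map_measurableEquiv (P.map fun ω => (X ω, Y ω)) ((P.map X).prod (P.map Y))
    (e.prodCongr f)
  rw [← h, Measure.map_map (e.prodCongr f).measurable (hX.prodMk hY),
    ← Measure.map_map e.measurable hX, ← Measure.map_map f.measurable hY,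
    Measure.map_prod_map _ _ e.measurable f.measurable]
  rfl

end MutualInfo

/-- An invertible matrix as a measurable bijection. -/
noncomputable def mulVecMeasurableEquiv {κ : Type*} [Fintype κ] [DecidableEq κ] (L : Matrix κ κ ℂ)
    (hL : L.det ≠ 0) : (κ → ℂ) ≃ᵐ (κ → ℂ) where
  toFun := L.mulVec
  invFun := L⁻¹.mulVec
  left_inv x := by rw [Matrix.mulVec_mulVec, Matrix.nonsing_inv_mul _ hL.isUnit, Matrix.one_mulVec]
  right_inv x := by rw [Matrix.mulVec_mulVec, Matrix.mul_nonsing_inv _ hL.isUnit, Matrix.one_mulVec]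
  measurable_toFun := measurable_mulVec L
  measurable_invFun := measurable_mulVec L⁻¹

lemma map_sumPiEquivProdPi_stdComplexGaussian (ι κ : Type*) [Fintype ι] [Fintype κ] :
    (stdComplexGaussian (ι ⊕ κ)).map (MeasurableEquiv.sumPiEquivProdPi fun _ => ℂ)
      = (stdComplexGaussian ι).prod (stdComplexGaussian κ) :=
  (measurePreserving_sumPiEquivProdPi (X := fun _ : ι ⊕ κ => ℂ) fun _ => complexGaussian 1).map_eq

/-- A positive semidefinite matrix is the covariance of a linear image of a standard vector. -/
lemma exists_mul_conjTranspose_eq {κ : Type*} [Fintype κ] [DecidableEq κ] {A : Matrix κ κ ℂ}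
    (hA : A.PosSemidef) : ∃ S : Matrix κ κ ℂ, S * Sᴴ = A := by
  open scoped MatrixOrder in
  obtain ⟨B, hB⟩ := CStarAlgebra.nonneg_iff_eq_mul_star_self.mp hA.nonneg
  exact ⟨B, hB.symm⟩

open InformationTheory in
/-- The capacity formula `I(x; T x + N w) = log (det (T Tᴴ + N Nᴴ) / det (N Nᴴ))` of a linear
channel with standard complex Gaussian input `x` and standard complex Gaussian noise `w`. With
`Q Qᴴ = T Tᴴ + N Nᴴ` and `S Sᴴ = N Nᴴ`, decorrelating the output by `Q⁻¹` makes the product of the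
marginals standard Gaussian and the joint law that of `L g` with `L = [1, 0; Q⁻¹ T, Q⁻¹ S]`. The
trace term of the divergence cancels because the marginals of `L g` are standard. -/
theorem mutualInfo_linear_channel {ι ν κ : Type*} [Fintype ι] [Fintype ν] [Fintype κ]
    [DecidableEq κ] (T : Matrix κ ι ℂ) (N : Matrix κ ν ℂ) (hN : (N * Nᴴ).det ≠ 0) :
    mutualInfo (fun p : (ι → ℂ) × (ν → ℂ) => p.1) (fun p => T *ᵥ p.1 + N *ᵥ p.2)
        ((stdComplexGaussian ι).prod (stdComplexGaussian ν)) ≠ ⊤ ∧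
    (mutualInfo (fun p : (ι → ℂ) × (ν → ℂ) => p.1) (fun p => T *ᵥ p.1 + N *ᵥ p.2)
        ((stdComplexGaussian ι).prod (stdComplexGaussian ν))).toReal
      = Real.log (‖(T * Tᴴ + N * Nᴴ).det‖ / ‖(N * Nᴴ).det‖) := by
  classical
  replace hN : (N * Nᴴ).PosDef :=
    (Matrix.posSemidef_self_mul_conjTranspose N).posDef_iff_det_ne_zero.mpr hN
  obtain ⟨S, hS⟩ := exists_mul_conjTranspose_eq hN.posSemidef
  have hR : (T * Tᴴ + N * Nᴴ).PosDef :=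
    Matrix.PosDef.posSemidef_add (Matrix.posSemidef_self_mul_conjTranspose T) hN
  obtain ⟨Q, hQ⟩ := exists_mul_conjTranspose_eq hR.posSemidef
  have hSd : ‖(N * Nᴴ).det‖ = ‖S.det‖ ^ 2 := by
    rw [← hS, Matrix.det_mul, Matrix.det_conjTranspose, norm_mul, norm_star, sq]
  have hQd : ‖(T * Tᴴ + N * Nᴴ).det‖ = ‖Q.det‖ ^ 2 := by
    rw [← hQ, Matrix.det_mul, Matrix.det_conjTranspose, norm_mul, norm_star, sq]
  have hS0 : S.det ≠ 0 := by
    intro h; rw [h] at hSd; exact hN.det_pos.ne' (by simpa using hSd)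
  have hQ0 : Q.det ≠ 0 := by
    intro h; rw [h] at hQd; exact hR.det_pos.ne' (by simpa using hQd)
  have hQQ : Q⁻¹ * Q = 1 := Matrix.nonsing_inv_mul _ hQ0.isUnit
  have hQQ' : Qᴴ * Q⁻¹ᴴ = 1 := by rw [← Matrix.conjTranspose_mul, hQQ, Matrix.conjTranspose_one]
  have hQQ'' : Q * Q⁻¹ = 1 := Matrix.mul_nonsing_inv _ hQ0.isUnit
  let D : Matrix (ι ⊕ κ) (ι ⊕ κ) ℂ := Matrix.fromBlocks 1 0 0 Q
  let L : Matrix (ι ⊕ κ) (ι ⊕ κ) ℂ := Matrix.fromBlocks 1 0 (Q⁻¹ * T) (Q⁻¹ * S)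
  let J : Matrix (ι ⊕ κ) (ι ⊕ ν) ℂ := Matrix.fromBlocks 1 0 T N
  have hD0 : D.det ≠ 0 := by simp [D, hQ0]
  have hLd : L.det = (Q.det)⁻¹ * S.det := by
    simp [L, Matrix.det_fromBlocks_zero₁₂, Matrix.det_nonsing_inv, Ring.inverse_eq_inv']
  have hL0 : L.det ≠ 0 := by rw [hLd]; positivity
  have hDL : D * L = Matrix.fromBlocks 1 0 T S := by
    simp [D, L, Matrix.fromBlocks_multiply, ← Matrix.mul_assoc, hQQ'']
  have hJ : (D * L) * (D * L)ᴴ = J * Jᴴ := by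
    rw [hDL]
    simp [J, Matrix.fromBlocks_conjTranspose, Matrix.fromBlocks_multiply, hS]
  have htr : (L * Lᴴ).trace = Fintype.card (ι ⊕ κ) := by
    have : Q⁻¹ * T * (Q⁻¹ * T)ᴴ + Q⁻¹ * S * (Q⁻¹ * S)ᴴ = 1 := by
      calc _ = Q⁻¹ * (T * Tᴴ + S * Sᴴ) * Q⁻¹ᴴ := by
            simp only [Matrix.conjTranspose_mul, Matrix.mul_add, Matrix.add_mul, Matrix.mul_assoc]
        _ = (Q⁻¹ * Q) * (Qᴴ * Q⁻¹ᴴ) := by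
            rw [hS, ← hQ]; simp only [Matrix.mul_assoc]
        _ = 1 := by rw [hQQ, hQQ', Matrix.one_mul]
    simp only [L, Matrix.fromBlocks_conjTranspose, Matrix.fromBlocks_multiply,
      this]
    simp [Matrix.trace]
  have hrow : Matrix.fromCols T N * (Matrix.fromCols T N)ᴴ = Q * Qᴴ := by
    rw [Matrix.conjTranspose_fromCols_eq_fromRows_conjTranspose, Matrix.fromCols_mul_fromRows, hQ]
  set γ := stdComplexGaussian (ι ⊕ κ)
  let e := MeasurableEquiv.sumPiEquivProdPi fun _ : ι ⊕ κ => ℂ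
  let e' := MeasurableEquiv.sumPiEquivProdPi fun _ : ι ⊕ ν => ℂ
  have hjoint : ((stdComplexGaussian ι).prod (stdComplexGaussian ν)).map
      (fun p => (p.1, T *ᵥ p.1 + N *ᵥ p.2))
        = ((γ.map L.mulVec).map (mulVecMeasurableEquiv D hD0)).map e := by
    have h1 : (fun p : (ι → ℂ) × (ν → ℂ) => (p.1, T *ᵥ p.1 + N *ᵥ p.2)) ∘ e' = e ∘ J.mulVec := by
      ext x i
      · change x (Sum.inl i) = (J *ᵥ x) (Sum.inl i)
        simp [J, Matrix.fromBlocks_mulVec]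
      · change _ = (J *ᵥ x) (Sum.inr i)
        simp only [J, Matrix.fromBlocks_mulVec, Sum.elim_inr]
        rfl
    have hmeas : Measurable (fun p : (ι → ℂ) × (ν → ℂ) => (p.1, T *ᵥ p.1 + N *ᵥ p.2)) :=
      measurable_fst.prodMk (((measurable_mulVec T).comp measurable_fst).add
        ((measurable_mulVec N).comp measurable_snd))
    rw [← map_sumPiEquivProdPi_stdComplexGaussian, Measure.map_map hmeas e'.measurable, h1,
      ← Measure.map_map e.measurable (measurable_mulVec J),
      ← map_mulVec_eq_of_mul_conjTranspose_eq _ _ hJ]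
    congr 1
    rw [Measure.map_map (MeasurableEquiv.measurable _) (measurable_mulVec L)]
    congr 1
    ext1 x
    exact (Matrix.mulVec_mulVec x D L).symm
  have hsnd : ((stdComplexGaussian ι).prod (stdComplexGaussian ν)).map
      (fun p => T *ᵥ p.1 + N *ᵥ p.2) = (stdComplexGaussian κ).map Q.mulVec := by
    have h1 : (fun p : (ι → ℂ) × (ν → ℂ) => T *ᵥ p.1 + N *ᵥ p.2) ∘ e' =
        (Matrix.fromCols T N).mulVec := by
      ext x i
      simp only [Matrix.fromCols_mulVec]
      rfl
    have hmeas : Measurable (fun p : (ι → ℂ) × (ν → ℂ) => T *ᵥ p.1 + N *ᵥ p.2) :=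
      ((measurable_mulVec T).comp measurable_fst).add ((measurable_mulVec N).comp measurable_snd)
    rw [← map_sumPiEquivProdPi_stdComplexGaussian, Measure.map_map hmeas e'.measurable, h1,
      map_mulVec_eq_of_mul_conjTranspose_eq _ _ hrow]
  have hprod : (stdComplexGaussian ι).prod ((stdComplexGaussian κ).map Q.mulVec)
      = (γ.map (mulVecMeasurableEquiv D hD0)).map e := by
    have h1 : Prod.map id Q.mulVec ∘ e = e ∘ (mulVecMeasurableEquiv D hD0) := by
      ext x i
      · change x (Sum.inl i) = (D *ᵥ x) (Sum.inl i)
        simp [D, Matrix.fromBlocks_mulVec]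
      · change _ = (D *ᵥ x) (Sum.inr i)
        simp only [D, Matrix.fromBlocks_mulVec, Sum.elim_inr, Matrix.zero_mulVec, zero_add]
        rfl
    have h2 : stdComplexGaussian ι = (stdComplexGaussian ι).map id := Measure.map_id.symm
    rw [h2, Measure.map_prod_map _ _ measurable_id (measurable_mulVec Q),
      ← map_sumPiEquivProdPi_stdComplexGaussian,
      Measure.map_map (measurable_id.prodMap (measurable_mulVec Q)) e.measurable, h1,
      Measure.map_map e.measurable (MeasurableEquiv.measurable _)]
  have : IsProbabilityMeasure (γ.map L.mulVec) :=
    Measure.isProbabilityMeasure_map (measurable_mulVec L).aemeasurable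
  unfold mutualInfo
  rw [hjoint, hsnd, show (fun p : (ι → ℂ) × (ν → ℂ) => p.1) = Prod.fst from rfl,
    measurePreserving_fst.map_eq, hprod, klDiv_map_measurableEquiv, klDiv_map_measurableEquiv,
    (klDiv_map_mulVec L hL0).2, htr, hSd, hQd, hLd]
  refine ⟨(klDiv_map_mulVec L hL0).1, ?_⟩
  simp only [Complex.natCast_re, sub_self, zero_sub]
  rw [← Real.log_inv]
  congr 1
  rw [norm_mul, norm_inv]
  field_simp

/-! ### The minislot as a linear channel -/

section Channel

variable {M m lF η : ℕ}

lemma wyner_transpose [NeZero M] (α : ℝ) : (wyner M α)ᵀ = wyner M α := by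
  ext i j
  have h : i - j = -(j - i) := (neg_sub j i).symm
  have h0 : -(j - i) = 0 ↔ j - i = 0 := neg_eq_zero
  have h1 : -(j - i) = 1 ↔ j - i = -1 := neg_eq_iff_eq_neg
  simp only [wyner, Matrix.transpose_apply, Matrix.circulant_apply, h, h0, h1, neg_inj]
  ring

lemma cableEq_transpose (γ : ℝ) : (cableEq m η γ)ᵀ = cableEq m η γ := by
  ext i j
  simp [cableEq, Matrix.one_apply, eq_comm]

lemma radioSignal_apply [NeZero M] (α : ℝ) (X Z : Fin m × Fin lF → Fin M → ℂ) (a : Fin M → Bool)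
    (p : Fin m × Fin lF) (k : Fin M) :
    radioSignal α X Z a p k = ∑ i, (((punct a * wyner M α) k i : ℝ) : ℂ) * X p i + Z p k := by
  have h : ∀ i, wyner M α k i = wyner M α i k := fun i =>
      congrFun (congrFun (wyner_transpose α) i) k
  simp only [radioSignal, punct, Matrix.add_apply, Matrix.diagonal_map Complex.ofReal_zero,
    Matrix.mul_diagonal,
    Matrix.mul_apply (M := Matrix.of X), Matrix.diagonal_mul, Matrix.of_apply, Matrix.map_apply, h]
  rw [Finset.sum_mul]
  congr 1
  exact Finset.sum_congr rfl fun i _ => by push_cast; ring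

/-- Combining the `η` pairs of a group turns the cable matrix into `cableEq` and averages the
cable noise over the group. -/
lemma cableOutput_apply [NeZero η] (γ g : ℝ) (y : Fin m × Fin lF → ℂ)
    (W : Fin lF → Fin m × Fin η → ℂ) (j : Fin m) (f : Fin lF) :
    cableOutput γ (cableInput η g y) W (j, f)
      = g * ∑ j', ((cableEq m η γ j j' : ℝ) : ℂ) * y (j', f) + (η : ℂ)⁻¹ * ∑ c, W f (j, c) := by
  have hη : (η : ℂ) ≠ 0 := Nat.cast_ne_zero.mpr (NeZero.ne η)
  have hc : ∀ j' j'' (c : Fin η), ∑ c', ((cable m η γ (j', c') (j'', c) : ℝ) : ℂ)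
      = ((cableEq m η γ j'' j' : ℝ) : ℂ) := by
    intro j' j'' c
    simp only [cable, cableEq, Matrix.add_apply, Matrix.smul_apply, Matrix.of_apply,
      Matrix.one_apply,
      Prod.mk.injEq, smul_eq_mul, mul_one]
    rw [← Complex.ofReal_sum, Finset.sum_add_distrib]
    by_cases h : j' = j''
    · simp [h]; ring
    · simp [h, Ne.symm h]; ring
  have hs : ∀ c, ∑ p : Fin m × Fin η, (g : ℂ) * y (p.1, f) * ((cable m η γ p (j, c) : ℝ) : ℂ)
      = g * ∑ j', ((cableEq m η γ j j' : ℝ) : ℂ) * y (j', f) := by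
    intro c
    rw [Fintype.sum_prod_type, Finset.mul_sum]
    refine Finset.sum_congr rfl fun j' _ => ?_
    calc _ = (g : ℂ) * y (j', f) * ∑ c', ((cable m η γ (j', c') (j, c) : ℝ) : ℂ) :=
          (Finset.mul_sum Finset.univ _ ((g : ℂ) * y (j', f))).symm
      _ = _ := by rw [hc]; ring
  simp only [cableOutput, cableInput, combiner, Matrix.vec, Matrix.mul_apply, Matrix.add_apply,
    Matrix.of_apply, Matrix.map_apply]
  rw [Fintype.sum_prod_type, Finset.sum_eq_single j]
  · simp only [hs, if_true]
    rw [← Finset.sum_mul, Finset.sum_add_distrib, Finset.sum_const, Finset.card_univ,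
      Fintype.card_fin,
      nsmul_eq_mul]
    push_cast
    field_simp
  · intro j' _ h; simp [h]
  · simp

/-- Output indices `(k, (j, f))` regrouped as `((k, j), f)`. -/
def outputEquiv (M m lF : ℕ) : Fin M × (Fin m × Fin lF) ≃ (Fin M × Fin m) × Fin lF :=
  (Equiv.prodAssoc _ _ _).symm

/-- Radio indices `((j, f), k)` regrouped as `((k, j), f)`. -/
def radioEquiv (M m lF : ℕ) : (Fin m × Fin lF) × Fin M ≃ (Fin M × Fin m) × Fin lF :=
  (Equiv.prodComm _ _).trans (outputEquiv M m lF)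

/-- The matrix from the normalized eMBB signals to the received signals: one copy of
`λ √P_B H_{B,eq}` for each of the `lF` channels of a sub-band. -/
noncomputable def signalMatrix [NeZero M] (m lF η : ℕ) (α γ PB Pc : ℝ) (a : Fin M → Bool) :
    Matrix (Fin M × (Fin m × Fin lF)) ((Fin m × Fin lF) × Fin M) ℝ :=
  (gain α PB Pc * Real.sqrt PB) •
    (channelEq m η α γ a ⊗ₖ (1 : Matrix (Fin lF) (Fin lF) ℝ)).submatrix
      (outputEquiv M m lF) (radioEquiv M m lF)

/-- The matrix from the radio noise to the received signals. -/
noncomputable def radioNoiseMatrix (M m lF η : ℕ) (α γ PB Pc : ℝ) :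
    Matrix (Fin M × (Fin m × Fin lF)) ((Fin m × Fin lF) × Fin M) ℝ :=
  gain α PB Pc • (((1 : Matrix (Fin M) (Fin M) ℝ) ⊗ₖ cableEq m η γ)
    ⊗ₖ (1 : Matrix (Fin lF) (Fin lF) ℝ)).submatrix (outputEquiv M m lF) (radioEquiv M m lF)

/-- The matrix from the cable noise to the received signals: averaging over a group of pairs. -/
noncomputable def cableNoiseMatrix (M m lF η : ℕ) :
    Matrix (Fin M × (Fin m × Fin lF)) ((Fin M × Fin lF) × (Fin m × Fin η)) ℝ :=
  Matrix.of fun i p => if p.1 = (i.1, i.2.2) ∧ p.2.1 = i.2.1 then (η : ℝ)⁻¹ else 0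

/-- The matrix from both noises to the received signals. -/
noncomputable def noiseMatrix (M m lF η : ℕ) (α γ PB Pc : ℝ) :
    Matrix (Fin M × (Fin m × Fin lF))
      (((Fin m × Fin lF) × Fin M) ⊕ ((Fin M × Fin lF) × (Fin m × Fin η))) ℝ :=
  Matrix.fromCols (radioNoiseMatrix M m lF η α γ PB Pc) (cableNoiseMatrix M m lF η)

/-- A matrix of the form `c (C ⊗ I)` acts on each of the `lF` channels of a sub-band separately. -/
lemma kronecker_submatrix_mulVec (C : Matrix (Fin M × Fin m) (Fin M × Fin m) ℝ)
    (c : ℝ) (x : (Fin m × Fin lF) × Fin M → ℂ) (k : Fin M) (j : Fin m) (f : Fin lF) :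
    (((c • (C ⊗ₖ (1 : Matrix (Fin lF) (Fin lF) ℝ)).submatrix (outputEquiv M m lF)
        (radioEquiv M m lF)).map Complex.ofReal) *ᵥ x) (k, (j, f))
      = c * ∑ j', ∑ i, (C (k, j) (i, j') : ℂ) * x ((j', f), i) := by
  simp only [Matrix.mulVec, dotProduct, Fintype.sum_prod_type, Matrix.map_apply, Matrix.smul_apply,
    Matrix.submatrix_apply, outputEquiv, radioEquiv, Matrix.kroneckerMap_apply, Equiv.trans_apply,
    Equiv.prodComm_apply, Equiv.prodAssoc_symm_apply, Prod.swap_prod_mk, Matrix.one_apply]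
  rw [Finset.mul_sum]
  refine Finset.sum_congr rfl fun j' _ => ?_
  rw [Finset.sum_eq_single f]
  · rw [Finset.mul_sum]
    exact Finset.sum_congr rfl fun i _ => by simp; ring
  · intro f' _ h; simp [Ne.symm h]
  · simp

/-- The received signals are the output of a linear channel. The channel multiplies by `H` from
the right and the matrix `channelEq` contains `B H`; they agree since `H` is symmetric. -/
lemma received_eq_mulVec [NeZero M] [NeZero η] (α γ PB Pc : ℝ) (a : Fin M → Bool)
    (x z : (Fin m × Fin lF) × Fin M → ℂ) (w : (Fin M × Fin lF) × (Fin m × Fin η) → ℂ) :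
    received α γ PB Pc (fun p k => (Real.sqrt PB : ℂ) * x (p, k)) (fun p k => z (p, k))
        (fun k f p => w ((k, f), p)) a
      = fun k p => ((signalMatrix m lF η α γ PB Pc a).map Complex.ofReal *ᵥ x
          + (noiseMatrix M m lF η α γ PB Pc).map Complex.ofReal *ᵥ Sum.elim z w) (k, p) := by
  ext k ⟨j, f⟩
  have hN : (noiseMatrix M m lF η α γ PB Pc).map Complex.ofReal *ᵥ Sum.elim z w
      = (radioNoiseMatrix M m lF η α γ PB Pc).map Complex.ofReal *ᵥ z
        + (cableNoiseMatrix M m lF η).map Complex.ofReal *ᵥ w := by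
    rw [← Matrix.fromCols_mulVec_sumElim]
    congr 1
    ext i (l | l) <;> rfl
  have hW : ((cableNoiseMatrix M m lF η).map Complex.ofReal *ᵥ w) (k, (j, f))
      = (η : ℂ)⁻¹ * ∑ c, w ((k, f), (j, c)) := by
    simp only [Matrix.mulVec, dotProduct, cableNoiseMatrix, Matrix.map_apply, Matrix.of_apply]
    rw [Fintype.sum_prod_type, Finset.sum_eq_single (k, f), Fintype.sum_prod_type,
      Finset.sum_eq_single j, Finset.mul_sum]
    · simp
    · intro j' _ h; simp [h]
    · simp
    · intro p _ h; simp [h]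
    · simp
  rw [hN, Pi.add_apply, Pi.add_apply, hW]
  unfold received signalMatrix radioNoiseMatrix
  rw [cableOutput_apply, kronecker_submatrix_mulVec, kronecker_submatrix_mulVec]
  simp only [radioSignal_apply, channelEq, Matrix.kroneckerMap_apply]
  rw [← add_assoc]
  congr 1
  simp only [mul_add, Finset.sum_add_distrib]
  congr 1
  · rw [Finset.mul_sum, Finset.mul_sum]
    refine Finset.sum_congr rfl fun j' _ => ?_
    rw [Finset.mul_sum, Finset.mul_sum, Finset.mul_sum]
    exact Finset.sum_congr rfl fun i _ => by push_cast; ring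
  · congr 1
    refine Finset.sum_congr rfl fun j' _ => ?_
    rw [Finset.sum_eq_single k]
    · simp
    · intro i _ h; simp [Ne.symm h]
    · simp

/-- The covariance of a channel that acts identically and independently on the `lF` channels. -/
lemma kronecker_submatrix_mul_transpose (C : Matrix (Fin M × Fin m) (Fin M × Fin m) ℝ) (c : ℝ) :
    (c • (C ⊗ₖ (1 : Matrix (Fin lF) (Fin lF) ℝ)).submatrix (outputEquiv M m lF) (radioEquiv M m lF))
      * (c • (C ⊗ₖ (1 : Matrix (Fin lF) (Fin lF) ℝ)).submatrix (outputEquiv M m lF)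
          (radioEquiv M m lF))ᵀ
      = (c ^ 2) • ((C * Cᵀ) ⊗ₖ (1 : Matrix (Fin lF) (Fin lF) ℝ)).submatrix (outputEquiv M m lF)
          (outputEquiv M m lF) := by
  rw [Matrix.transpose_smul, Matrix.transpose_submatrix, Matrix.smul_mul, Matrix.mul_smul,
    smul_smul,
    Matrix.submatrix_mul_equiv, ← sq]
  congr 2
  rw [← Matrix.kroneckerMap_transpose, Matrix.transpose_one, ← Matrix.mul_kronecker_mul, mul_one]

lemma cableNoiseMatrix_mul_transpose [NeZero η] :
    cableNoiseMatrix M m lF η * (cableNoiseMatrix M m lF η)ᵀ = (η : ℝ)⁻¹ • 1 := by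
  have hη : (η : ℝ) ≠ 0 := Nat.cast_ne_zero.mpr (NeZero.ne η)
  ext ⟨k, j, f⟩ ⟨k', j', f'⟩
  simp only [Matrix.mul_apply, Matrix.transpose_apply, cableNoiseMatrix, Matrix.of_apply]
  rw [Fintype.sum_prod_type, Finset.sum_eq_single (k, f), Fintype.sum_prod_type,
      Finset.sum_eq_single j]
  · by_cases h : k = k' ∧ j = j' ∧ f = f'
    · obtain ⟨rfl, rfl, rfl⟩ := h
      simp
      field_simp
    · have h1 : ¬ (((k, f) = (k', f')) ∧ j = j') := fun h' => h (by simp_all)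
      have h2 : ((k, j, f) : Fin M × Fin m × Fin lF) ≠ (k', j', f') := fun h' => h (by simp_all)
      simp only [h1, if_false, mul_zero, Finset.sum_const_zero, Matrix.smul_apply,
        Matrix.one_apply_ne h2, smul_zero]
  · intro j' _ h; simp [h]
  · simp
  · intro p _ h; simp [h]
  · simp

lemma signalMatrix_mul_transpose [NeZero M] {α γ PB Pc : ℝ} (hPB : 0 < PB) (a : Fin M → Bool) :
    signalMatrix m lF η α γ PB Pc a * (signalMatrix m lF η α γ PB Pc a)ᵀ
      = (gain α PB Pc ^ 2) • ((PB • (channelEq m η α γ a * (channelEq m η α γ a)ᵀ))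
          ⊗ₖ (1 : Matrix (Fin lF) (Fin lF) ℝ)).submatrix (outputEquiv M m lF)
            (outputEquiv M m lF) := by
  rw [signalMatrix, kronecker_submatrix_mul_transpose, mul_pow, Real.sq_sqrt hPB.le, mul_smul,
    Matrix.smul_kronecker, Matrix.submatrix_smul]
  rfl

lemma gain_pos {α PB Pc : ℝ} (hPB : 0 < PB) (hPc : 0 < Pc) : 0 < gain α PB Pc :=
  Real.sqrt_pos.mpr (by positivity)

lemma noiseMatrix_mul_transpose [NeZero η] {α γ PB Pc : ℝ} (hPB : 0 < PB) (hPc : 0 < Pc) :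
    noiseMatrix M m lF η α γ PB Pc * (noiseMatrix M m lF η α γ PB Pc)ᵀ
      = (gain α PB Pc ^ 2) • (noiseCov M m η α γ PB Pc
          ⊗ₖ (1 : Matrix (Fin lF) (Fin lF) ℝ)).submatrix (outputEquiv M m lF)
            (outputEquiv M m lF) := by
  have hη : (η : ℝ) ≠ 0 := Nat.cast_ne_zero.mpr (NeZero.ne η)
  have hg := (gain_pos (α := α) hPB hPc).ne'
  rw [noiseMatrix, Matrix.transpose_fromCols, Matrix.fromCols_mul_fromRows,
    cableNoiseMatrix_mul_transpose, radioNoiseMatrix, kronecker_submatrix_mul_transpose, noiseCov,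
    Matrix.add_kronecker, Matrix.submatrix_add, Pi.add_apply, Pi.add_apply, smul_add]
  congr 1
  · rw [← Matrix.kroneckerMap_transpose, Matrix.transpose_one, cableEq_transpose,
      ← Matrix.mul_kronecker_mul, mul_one]
  · rw [Matrix.smul_kronecker, Matrix.one_kronecker_one, Matrix.submatrix_smul, Pi.smul_apply,
      Pi.smul_apply, Matrix.submatrix_one_equiv, smul_smul]
    congr 1
    field_simp

lemma noiseCov_posDef [NeZero η] {α γ PB Pc : ℝ} (hPB : 0 < PB) (hPc : 0 < Pc) :
    (noiseCov M m η α γ PB Pc).PosDef := by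
  have hη : (0 : ℝ) < η := Nat.cast_pos.mpr (NeZero.pos η)
  have hg := gain_pos (α := α) hPB hPc
  refine Matrix.PosDef.posSemidef_add ?_ (Matrix.PosDef.one.smul (by positivity))
  have h : (1 : Matrix (Fin M) (Fin M) ℝ) ⊗ₖ (cableEq m η γ * cableEq m η γ)
      = ((1 : Matrix (Fin M) (Fin M) ℝ) ⊗ₖ cableEq m η γ)
        * ((1 : Matrix (Fin M) (Fin M) ℝ) ⊗ₖ cableEq m η γ)ᴴ := by
    rw [Matrix.conjTranspose_kronecker, Matrix.conjTranspose_one,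
      Matrix.conjTranspose_eq_transpose_of_trivial, cableEq_transpose, ← Matrix.mul_kronecker_mul,
      mul_one]
  rw [h]
  exact Matrix.posSemidef_self_mul_conjTranspose _

/-- The ratio of the determinants of the output and noise covariances, the noise covariance being
invertible. The Kronecker factor of size `lF` becomes the exponent `lF`. The absolute values come
from passing through complex determinants. -/
lemma log_det_ratio [NeZero M] [NeZero η] {α γ PB Pc : ℝ} (hPB : 0 < PB) (hPc : 0 < Pc)
    (a : Fin M → Bool) :
    (noiseMatrix M m lF η α γ PB Pc * (noiseMatrix M m lF η α γ PB Pc)ᵀ).det ≠ 0 ∧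
    Real.log (|(signalMatrix m lF η α γ PB Pc a * (signalMatrix m lF η α γ PB Pc a)ᵀ
        + noiseMatrix M m lF η α γ PB Pc * (noiseMatrix M m lF η α γ PB Pc)ᵀ).det|
        / |(noiseMatrix M m lF η α γ PB Pc * (noiseMatrix M m lF η α γ PB Pc)ᵀ).det|)
      = lF * Real.log (1 + PB • ((noiseCov M m η α γ PB Pc)⁻¹
        * channelEq m η α γ a * (channelEq m η α γ a)ᵀ)).det := by
  have hR : (noiseCov M m η α γ PB Pc).det ≠ 0 := (noiseCov_posDef hPB hPc).det_pos.ne'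
  have hg := (gain_pos (α := α) hPB hPc).ne'
  set R := noiseCov M m η α γ PB Pc
  set C := channelEq m η α γ a
  set g := gain α PB Pc
  have key : ∀ A : Matrix (Fin M × Fin m) (Fin M × Fin m) ℝ,
      ((g ^ 2) • (A ⊗ₖ (1 : Matrix (Fin lF) (Fin lF) ℝ)).submatrix (outputEquiv M m lF)
        (outputEquiv M m lF)).det
        = (g ^ 2) ^ Fintype.card (Fin M × (Fin m × Fin lF)) * A.det ^ lF := by
    intro A
    rw [Matrix.det_smul, Matrix.det_submatrix_equiv_self, Matrix.det_kronecker]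
    simp
  have hsum : PB • (C * Cᵀ) + R = R * (1 + PB • (R⁻¹ * C * Cᵀ)) := by
    rw [mul_add, mul_one, Matrix.mul_smul, ← Matrix.mul_assoc, ← Matrix.mul_assoc,
      Matrix.mul_nonsing_inv _ hR.isUnit, Matrix.one_mul, add_comm]
  rw [signalMatrix_mul_transpose hPB, noiseMatrix_mul_transpose hPB hPc, ← smul_add,
    ← Pi.add_apply, ← Pi.add_apply, ← Matrix.submatrix_add, ← Matrix.add_kronecker, key, key,
    hsum, Matrix.det_mul]
  have h0 : (g ^ 2) ^ Fintype.card (Fin M × (Fin m × Fin lF)) * R.det ^ lF ≠ 0 := by positivity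
  refine ⟨h0, ?_⟩
  rw [mul_pow, ← mul_assoc, abs_mul, mul_div_cancel_left₀ _ (abs_ne_zero.mpr h0), Real.log_abs,
    Real.log_pow]

end Channel

/-! ### Laws of the signals given the activity pattern -/

/-- Currying identifies an i.i.d. family over `ι × κ` with an i.i.d. family of i.i.d. families. -/
lemma pi_map_curry (ι κ : Type*) [Fintype ι] [Fintype κ] {α : Type*} [MeasurableSpace α]
    (μ : Measure α) [IsProbabilityMeasure μ] :
    (Measure.pi fun _ : ι × κ => μ).map (MeasurableEquiv.curry ι κ α)
      = Measure.pi fun _ : ι => Measure.pi fun _ : κ => μ := by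
  rw [MeasurableEquiv.map_apply_eq_iff_map_symm_apply_eq]
  refine Measure.pi_eq fun s hs => ?_
  rw [MeasurableEquiv.map_apply]
  have h : (MeasurableEquiv.curry ι κ α).symm ⁻¹' (Set.univ.pi s)
      = Set.univ.pi fun i => Set.univ.pi fun k => s (i, k) := by
    ext x
    simp only [Set.mem_preimage, Set.mem_pi, Set.mem_univ, true_imp_iff, Prod.forall]
    rfl
  rw [h, Measure.pi_pi, Fintype.prod_prod_type]
  simp only [Measure.pi_pi]

lemma stdComplexGaussian_map_smul (ι : Type*) [Fintype ι] {v : ℝ} (hv : 0 ≤ v) :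
    (stdComplexGaussian ι).map (fun x => (Real.sqrt v : ℂ) • x)
      = Measure.pi fun _ : ι => complexGaussian v := by
  have h := Measure.pi_map_pi (ι := ι) (μ := fun _ => complexGaussian 1)
    (f := fun _ z => (Real.sqrt v : ℂ) * z)
    (hμ := fun _ => by rw [complexGaussian_map_mul hv]; infer_instance) fun _ => by fun_prop
  simp only [complexGaussian_map_mul hv] at h
  exact h

/-- The joint law of the eMBB signals, the radio noise and the cable noise. -/
noncomputable def signalLaw (M m lF η : ℕ) (PB : ℝ) :
    Measure ((Fin m × Fin lF → Fin M → ℂ) × (Fin m × Fin lF → Fin M → ℂ) ×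
      (Fin M → Fin lF → Fin m × Fin η → ℂ)) :=
  (Measure.pi fun _ => Measure.pi fun _ => complexGaussian PB).prod <|
  (Measure.pi fun _ => Measure.pi fun _ => complexGaussian 1).prod <|
  (Measure.pi fun _ => Measure.pi fun _ => Measure.pi fun _ => complexGaussian 1)

instance isProbabilityMeasure_signalLaw (M m lF η : ℕ) (PB : ℝ) :
    IsProbabilityMeasure (signalLaw M m lF η PB) := by
  unfold signalLaw; infer_instance

lemma frameLaw_map_assoc (M m lF η : ℕ) (PB : ℝ) (q : unitInterval) :
    (frameLaw M m lF η PB q).map (fun p => ((p.1, p.2.1, p.2.2.1), p.2.2.2))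
      = (signalLaw M m lF η PB).prod (Measure.pi fun _ => bernoulliMeasure true false q) := by
  have e1 := (MeasurePreserving.id (Measure.pi fun _ : Fin m × Fin lF =>
    Measure.pi fun _ : Fin M => complexGaussian PB)).prod
    ((measurePreserving_prodAssoc (Measure.pi fun _ : Fin m × Fin lF =>
        Measure.pi fun _ : Fin M => complexGaussian 1)
      (Measure.pi fun _ : Fin M => Measure.pi fun _ : Fin lF => Measure.pi fun _ : Fin m × Fin η =>
        complexGaussian 1)
      (Measure.pi fun _ : Fin M => bernoulliMeasure true false q)).symm)
  have e2 := (measurePreserving_prodAssoc (Measure.pi fun _ : Fin m × Fin lF =>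
      Measure.pi fun _ : Fin M => complexGaussian PB)
    ((Measure.pi fun _ : Fin m × Fin lF => Measure.pi fun _ : Fin M => complexGaussian 1).prod
      (Measure.pi fun _ : Fin M => Measure.pi fun _ : Fin lF => Measure.pi fun _ : Fin m × Fin η =>
        complexGaussian 1))
    (Measure.pi fun _ : Fin M => bernoulliMeasure true false q)).symm
  exact (e2.comp e1).map_eq

section Recoding

variable (M m lF η : ℕ)

/-- Arranging a standard Gaussian vector as the eMBB signals. -/
noncomputable def signalRecoding {PB : ℝ} (hPB : 0 < PB) :
    ((Fin m × Fin lF) × Fin M → ℂ) ≃ᵐ (Fin m × Fin lF → Fin M → ℂ) :=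
  (MeasurableEquiv.smul₀ (Real.sqrt PB : ℂ)
    (Complex.ofReal_ne_zero.mpr (Real.sqrt_pos.mpr hPB).ne')).trans (MeasurableEquiv.curry _ _ _)

/-- Arranging a standard Gaussian vector as the radio noise and the cable noise. -/
noncomputable def noiseRecoding :
    (((Fin m × Fin lF) × Fin M) ⊕ ((Fin M × Fin lF) × (Fin m × Fin η)) → ℂ) ≃ᵐ
      (Fin m × Fin lF → Fin M → ℂ) × (Fin M → Fin lF → Fin m × Fin η → ℂ) :=
  (MeasurableEquiv.sumPiEquivProdPi fun _ => ℂ).trans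
    ((MeasurableEquiv.curry _ _ _).prodCongr
      ((MeasurableEquiv.curry _ _ _).trans (MeasurableEquiv.curry _ _ _)))

lemma map_recoding {PB : ℝ} (hPB : 0 < PB) :
    ((stdComplexGaussian ((Fin m × Fin lF) × Fin M)).prod
      (stdComplexGaussian (((Fin m × Fin lF) × Fin M) ⊕ ((Fin M × Fin lF) × (Fin m × Fin η))))).map
        (Prod.map (signalRecoding M m lF hPB) (noiseRecoding M m lF η))
      = signalLaw M m lF η PB := by
  rw [← Measure.map_prod_map _ _ (MeasurableEquiv.measurable _) (MeasurableEquiv.measurable _)]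
  unfold signalLaw
  congr 1
  · rw [signalRecoding, MeasurableEquiv.coe_trans, ← Measure.map_map (MeasurableEquiv.measurable _)
      (MeasurableEquiv.measurable _), ← pi_map_curry, ← stdComplexGaussian_map_smul _ hPB.le]
    rfl
  · rw [noiseRecoding, MeasurableEquiv.coe_trans, ← Measure.map_map (MeasurableEquiv.measurable _)
      (MeasurableEquiv.measurable _), map_sumPiEquivProdPi_stdComplexGaussian]
    change Measure.map (Prod.map (MeasurableEquiv.curry (Fin m × Fin lF) (Fin M) ℂ)
      ((MeasurableEquiv.curry (Fin M × Fin lF) (Fin m × Fin η) ℂ).trans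
        (MeasurableEquiv.curry (Fin M) (Fin lF) (Fin m × Fin η → ℂ)))) _ = _
    rw [← Measure.map_prod_map _ _ (MeasurableEquiv.measurable _) (MeasurableEquiv.measurable _),
      MeasurableEquiv.coe_trans, ← Measure.map_map (MeasurableEquiv.measurable _)
      (MeasurableEquiv.measurable _)]
    unfold stdComplexGaussian
    rw [pi_map_curry, pi_map_curry, pi_map_curry]

end Recoding

lemma measurable_received {M m lF η : ℕ} [NeZero M] [NeZero η] (α γ PB Pc : ℝ)
    (a : Fin M → Bool) :
    Measurable fun p : (Fin m × Fin lF → Fin M → ℂ) × (Fin m × Fin lF → Fin M → ℂ) ×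
      (Fin M → Fin lF → Fin m × Fin η → ℂ) => received α γ PB Pc p.1 p.2.1 p.2.2 a := by
  refine measurable_pi_lambda _ fun k => measurable_pi_lambda _ fun ⟨j, f⟩ => ?_
  simp only [received, cableOutput_apply, radioSignal_apply]
  fun_prop

lemma norm_det_map_ofReal {n : Type*} [Fintype n] [DecidableEq n] (A : Matrix n n ℝ) :
    ‖(A.map Complex.ofReal).det‖ = |A.det| := by
  have := RingHom.map_det Complex.ofRealHom A
  rw [← Real.norm_eq_abs, ← Complex.norm_real]
  exact congrArg _ this.symm

lemma map_ofReal_mul_conjTranspose {n l : Type*} [Fintype l] (A : Matrix n l ℝ) :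
    A.map Complex.ofReal * (A.map Complex.ofReal)ᴴ = (A * Aᵀ).map Complex.ofReal := by
  ext i j
  simp [Matrix.mul_apply]

/-- The information carried in a minislot with activity pattern `a`. The recodings turn the
signals into standard complex Gaussian vectors, and `received_eq_mulVec` then makes this an
instance of `mutualInfo_linear_channel`. -/
lemma mutualInfo_received (M m lF η : ℕ) [NeZero M] [NeZero η] {α γ PB Pc : ℝ}
    (hPB : 0 < PB) (hPc : 0 < Pc) (a : Fin M → Bool) :
    mutualInfo (fun p => p.1) (fun p => received α γ PB Pc p.1 p.2.1 p.2.2 a)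
        (signalLaw M m lF η PB) ≠ ⊤ ∧
    (mutualInfo (fun p => p.1) (fun p => received α γ PB Pc p.1 p.2.1 p.2.2 a)
        (signalLaw M m lF η PB)).toReal
      = lF * Real.log (1 + PB • ((noiseCov M m η α γ PB Pc)⁻¹
        * channelEq m η α γ a * (channelEq m η α γ a)ᵀ)).det := by
  set T := signalMatrix m lF η α γ PB Pc a
  set N := noiseMatrix M m lF η α γ PB Pc
  obtain ⟨hdet, hlog⟩ := log_det_ratio (m := m) (lF := lF) (η := η) (α := α) (γ := γ) hPB hPc a
  have hN : (N.map Complex.ofReal * (N.map Complex.ofReal)ᴴ).det ≠ 0 := by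
    rw [map_ofReal_mul_conjTranspose, ← norm_ne_zero_iff, norm_det_map_ofReal]
    exact abs_ne_zero.mpr hdet
  have hadd : T.map Complex.ofReal * (T.map Complex.ofReal)ᴴ
      + N.map Complex.ofReal * (N.map Complex.ofReal)ᴴ = (T * Tᵀ + N * Nᵀ).map Complex.ofReal := by
    rw [map_ofReal_mul_conjTranspose, map_ofReal_mul_conjTranspose]
    ext i j
    simp
  have hch := mutualInfo_linear_channel (T.map Complex.ofReal) (N.map Complex.ofReal) hN
  rw [hadd, map_ofReal_mul_conjTranspose N, norm_det_map_ofReal, norm_det_map_ofReal, hlog] at hch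
  have hrecv := measurable_received (m := m) (lF := lF) (η := η) α γ PB Pc a
  have hY : Measurable fun p : ((Fin m × Fin lF) × Fin M → ℂ) ×
      (((Fin m × Fin lF) × Fin M) ⊕ ((Fin M × Fin lF) × (Fin m × Fin η)) → ℂ) =>
        T.map Complex.ofReal *ᵥ p.1 + N.map Complex.ofReal *ᵥ p.2 :=
    ((measurable_mulVec _).comp measurable_fst).add ((measurable_mulVec _).comp measurable_snd)
  have heq : mutualInfo (fun p => p.1) (fun p => received α γ PB Pc p.1 p.2.1 p.2.2 a)
        (signalLaw M m lF η PB)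
      = mutualInfo (fun p => p.1)
        (fun p => T.map Complex.ofReal *ᵥ p.1 + N.map Complex.ofReal *ᵥ p.2)
        ((stdComplexGaussian ((Fin m × Fin lF) × Fin M)).prod (stdComplexGaussian
          (((Fin m × Fin lF) × Fin M) ⊕ ((Fin M × Fin lF) × (Fin m × Fin η))))) := by
    rw [← map_recoding M m lF η hPB, mutualInfo_map ((MeasurableEquiv.measurable _).prodMap
        (MeasurableEquiv.measurable _)).aemeasurable measurable_fst hrecv,
      ← mutualInfo_measurableEquiv_comp measurable_fst hY (signalRecoding M m lF hPB)
        (MeasurableEquiv.curry (Fin M) (Fin m × Fin lF) ℂ)]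
    congr 1
    ext1 p
    have := received_eq_mulVec (M := M) (m := m) (lF := lF) α γ PB Pc a p.1
      (p.2 ∘ Sum.inl) (p.2 ∘ Sum.inr)
    rw [Sum.elim_comp_inl_inr] at this
    exact this
  rw [heq]
  exact hch

lemma aemeasurable_signals_activity {Ω : Type*} [MeasurableSpace Ω] {P : Measure Ω}
    {M m lF η : ℕ} {PB : ℝ} {q : unitInterval}
    {X Z : Ω → Fin m × Fin lF → Fin M → ℂ} {W : Ω → Fin M → Fin lF → Fin m × Fin η → ℂ}
    {A : Ω → Fin M → Bool}
    (hlaw : HasLaw (fun ω => (X ω, Z ω, W ω, A ω)) (frameLaw M m lF η PB q) P) :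
    AEMeasurable (fun ω => (X ω, Z ω, W ω)) P ∧ AEMeasurable A P := by
  have h := hlaw.aemeasurable
  exact ⟨h.fst.prodMk (h.snd.fst.prodMk h.snd.snd.fst), h.snd.snd.snd⟩

/-- The signals are independent of the activity pattern, so conditioning on a pattern of positive
probability leaves their law unchanged. -/
lemma cond_map_signals {Ω : Type*} [MeasurableSpace Ω] (P : Measure Ω) [IsProbabilityMeasure P]
    {M m lF η : ℕ} {PB : ℝ} {q : unitInterval}
    {X Z : Ω → Fin m × Fin lF → Fin M → ℂ} {W : Ω → Fin M → Fin lF → Fin m × Fin η → ℂ}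
    {A : Ω → Fin M → Bool}
    (hlaw : HasLaw (fun ω => (X ω, Z ω, W ω, A ω)) (frameLaw M m lF η PB q) P) (a : Fin M → Bool)
    (ha : P (A ⁻¹' {a}) ≠ 0) :
    (ProbabilityTheory.cond P (A ⁻¹' {a})).map (fun ω => (X ω, Z ω, W ω))
      = signalLaw M m lF η PB := by
  have hm := hlaw.aemeasurable
  obtain ⟨hV, hA⟩ := aemeasurable_signals_activity hlaw
  have hjoint : P.map (fun ω => ((X ω, Z ω, W ω), A ω))
      = (signalLaw M m lF η PB).prod (Measure.pi fun _ => bernoulliMeasure true false q) := by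
    rw [← frameLaw_map_assoc, ← hlaw.map_eq,
      AEMeasurable.map_map_of_aemeasurable (by fun_prop) hm]
    rfl
  have hrect : ∀ s, MeasurableSet s → P (A ⁻¹' {a} ∩ (fun ω => (X ω, Z ω, W ω)) ⁻¹' s)
      = signalLaw M m lF η PB s * (Measure.pi fun _ => bernoulliMeasure true false q) {a} := by
    intro s hs
    rw [← Measure.prod_prod, ← hjoint, Measure.map_apply_of_aemeasurable (hV.prodMk hA)
      (hs.prod (measurableSet_singleton a)), Set.inter_comm]
    rfl
  have hPA : P (A ⁻¹' {a}) = (Measure.pi fun _ => bernoulliMeasure true false q) {a} := by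
    have := hrect Set.univ MeasurableSet.univ
    simpa using this
  have hAs : NullMeasurableSet (A ⁻¹' {a}) P :=
    hA.nullMeasurableSet_preimage (measurableSet_singleton a)
  ext s hs
  have hac : ProbabilityTheory.cond P (A ⁻¹' {a}) ≪ P := cond_absolutelyContinuous
  rw [Measure.map_apply_of_aemeasurable (hV.mono_ac hac) hs, ProbabilityTheory.cond,
    Measure.smul_apply, Measure.restrict_apply₀' hAs, Set.inter_comm, hrect s hs, ← hPA,
    smul_eq_mul,
    mul_comm, mul_assoc, ENNReal.mul_inv_cancel ha (measure_ne_top _ _), mul_one]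

end AnalogCRAN

/-! ### The eMBB rate -/

open AnalogCRAN in
theorem lemma3 {Ω : Type*} [MeasurableSpace Ω] (P : Measure Ω) [IsProbabilityMeasure P]
    (M m lF η : ℕ) [NeZero M] [NeZero m] [NeZero lF] [NeZero η]
    (α γ PB Pc : ℝ) (q : unitInterval)
    (hα : α ∈ Set.Icc (0 : ℝ) 1) (hγ : 0 ≤ γ) (hPB : 0 < PB) (hPc : 0 < Pc)
    (X Z : Ω → Fin m × Fin lF → Fin M → ℂ)
    (W : Ω → Fin M → Fin lF → Fin m × Fin η → ℂ)
    (A : Ω → Fin M → Bool)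
    (hlaw : HasLaw (fun ω => (X ω, Z ω, W ω, A ω)) (AnalogCRAN.frameLaw M m lF η PB q) P) :
    AnalogCRAN.eMBBInfo α γ PB Pc P X Z W A ≠ ⊤ ∧
    Integrable (fun ω => Real.logb 2
      (1 + PB • ((AnalogCRAN.noiseCov M m η α γ PB Pc)⁻¹
        * AnalogCRAN.channelEq m η α γ (A ω) * (AnalogCRAN.channelEq m η α γ (A ω))ᵀ)).det) P ∧
    AnalogCRAN.eMBBRate α γ PB Pc P X Z W A =
      AnalogCRAN.cableBandwidth m lF / (M : ℝ) *
        ∫ ω, Real.logb 2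
          (1 + PB • ((AnalogCRAN.noiseCov M m η α γ PB Pc)⁻¹
            * AnalogCRAN.channelEq m η α γ (A ω)
            * (AnalogCRAN.channelEq m η α γ (A ω))ᵀ)).det ∂P := by
  obtain ⟨hV, hA⟩ := aemeasurable_signals_activity hlaw
  have hAs : ∀ a, NullMeasurableSet (A ⁻¹' {a}) P := fun a =>
    hA.nullMeasurableSet_preimage (measurableSet_singleton a)
  set D : (Fin M → Bool) → ℝ := fun a => (1 + PB • ((noiseCov M m η α γ PB Pc)⁻¹
        * channelEq m η α γ a * (channelEq m η α γ a)ᵀ)).det with hD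
  have hinfo : ∀ a, P (A ⁻¹' {a}) ≠ 0 →
      mutualInfo X (fun ω => received α γ PB Pc (X ω) (Z ω) (W ω) (A ω))
        (ProbabilityTheory.cond P (A ⁻¹' {a})) ≠ ⊤ ∧
      (mutualInfo X (fun ω => received α γ PB Pc (X ω) (Z ω) (W ω) (A ω))
        (ProbabilityTheory.cond P (A ⁻¹' {a}))).toReal = lF * Real.log (D a) := by
    intro a ha
    have hrecv := measurable_received (m := m) (lF := lF) (η := η) α γ PB Pc a
    have hV' := hV.mono_ac (cond_absolutelyContinuous (s := A ⁻¹' {a}))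
    have h := mutualInfo_received M m lF η (α := α) (γ := γ) hPB hPc a
    rw [← cond_map_signals P hlaw a ha, mutualInfo_map hV' measurable_fst hrecv] at h
    rw [mutualInfo_congr (X' := X) (Y' := fun ω => received α γ PB Pc (X ω) (Z ω) (W ω) a)
      Filter.EventuallyEq.rfl]
    · exact h
    -- The conditional law is carried by `A = a`.
    · filter_upwards [ae_cond_mem₀ (hAs a)] with ω hω
      rw [show A ω = a from hω]
  have hterm : ∀ a, P (A ⁻¹' {a}) * mutualInfo X
      (fun ω => received α γ PB Pc (X ω) (Z ω) (W ω) (A ω))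
      (ProbabilityTheory.cond P (A ⁻¹' {a})) ≠ ⊤ := by
    intro a
    by_cases ha : P (A ⁻¹' {a}) = 0
    · simp [ha]
    · exact ENNReal.mul_ne_top (measure_ne_top _ _) (hinfo a ha).1
  have : IsProbabilityMeasure (P.map A) := Measure.isProbabilityMeasure_map hA
  have hint : ∀ g : (Fin M → Bool) → ℝ, Integrable g (P.map A) := fun g => Integrable.of_finite
  have hgm : ∀ g : (Fin M → Bool) → ℝ, AEStronglyMeasurable g (P.map A) := fun g =>
    (hint g).aestronglyMeasurable
  refine ⟨?_, ?_, ?_⟩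
  · exact ENNReal.sum_ne_top.mpr fun a _ => hterm a
  · exact (integrable_map_measure (hgm fun a => Real.logb 2 (D a)) hA).mp (hint _)
  · have hE : ∫ ω, Real.logb 2 (D (A ω)) ∂P
        = ∑ a, (P (A ⁻¹' {a})).toReal * Real.logb 2 (D a) := by
      rw [← integral_map hA (hgm fun a => Real.logb 2 (D a)), integral_fintype (hint _)]
      refine Finset.sum_congr rfl fun a _ => ?_
      rw [measureReal_def, Measure.map_apply_of_aemeasurable hA (measurableSet_singleton a),
        smul_eq_mul]
    have hI : (eMBBInfo α γ PB Pc P X Z W A).toReal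
        = lF * ∑ a, (P (A ⁻¹' {a})).toReal * Real.log (D a) := by
      unfold eMBBInfo condMutualInfo
      rw [ENNReal.toReal_sum fun a _ => hterm a, Finset.mul_sum]
      refine Finset.sum_congr rfl fun a _ => ?_
      -- Patterns of probability zero contribute nothing to either side.
      by_cases ha : P (A ⁻¹' {a}) = 0
      · simp [ha]
      · rw [ENNReal.toReal_mul, (hinfo a ha).2]; ring
    change _ = _ * ∫ ω, Real.logb 2 (D (A ω)) ∂P
    rw [hE, eMBBRate, hI, cableBandwidth]
    simp only [Real.logb, mul_div_assoc']
    rw [← Finset.sum_div]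
    ring
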